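/- Let $\Bbbk$ be a field of characteristic zero. Let $\Lambda'$ be the free associative $\Bbbk$-algebra on generators $h_1,h_2,\dots$, graded by $\deg h_n=n$, and put $h_0=1$. For a composition $\alpha=(a_1,\dots,a_r)$ of $n$ (a finite sequence of positive integers with sum $|\alpha|=n$) write $h_\alpha=h_{a_1}\cdots h_{a_r}$ and let $S_\alpha=S_{a_1}\times\cdots\times S_{a_r}\subset S_n$ be the corresponding parabolic subgroup. Equip $\Lambda'$ with the symmetric $\Bbbk$-bilinear form given on words by $$(h_\beta,h_\alpha)=\sum_{c\in S_\beta\backslash S_n/S_\alpha}(-1)^{\ell(c)}\quad\text{if }|\alpha|=|\beta|=n,\qquad (h_\beta,h_\alpha)=0\quad\text{if }|\alpha|\neq|\beta|,$$ where $\ell(c)$ is the length (number of inversions) of a minimal length element of the double coset $c$. Let $\mathcal I=\{x\in\Lambda' : (x,y)=0\text{ for all }y\in\Lambda'\}$ be the radical of this form. Then $\mathcal I$ is a two-sided ideal, so that the algebra of odd symmetric functions $\Lambda=\Lambda^{-1}=\Lambda'/\mathcal I$ is a graded algebra $\Lambda=\bigoplus_n\Lambda_n$ with an induced bilinear form. For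 a partition $\lambda=(\lambda_1\ge\lambda_2\ge\cdots)$ let $h_\lambda=h_{\lambda_1}h_{\lambda_2}\cdots\in\Lambda$. For every $n\ge0$ there is exactly one family $(m_\mu)_{\mu\vdash n}$ in $\Lambda_n$ (the odd monomial symmetric functions) such that $(h_\lambda,m_\mu)=\delta_{\lambda\mu}$ for all partitions $\lambda,\mu$ of $n$. Define the odd power symmetric function $p_k=m_{(k)}$ for $k\ge 1$, and $p_0=m_\varnothing$. Then, for every $k\ge0$, the element $p_k$ belongs to the center of the algebra $\Lambda$ if and only if $k$ is even. -/

import Mathlib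

namespace OddSymm

noncomputable section

/-! ### Parabolic subgroups, lengths and double cosets -/

/-- The Coxeter length of a permutation: the number of pairs `i < j` with `σ i > σ j`. -/
def permLength {n : ℕ} (σ : Equiv.Perm (Fin n)) : ℕ :=
  (Finset.univ.filter fun p : Fin n × Fin n => p.1 < p.2 ∧ σ p.2 < σ p.1).card

/-- The parabolic subgroup `S_α = S_{a₁} × ⋯ × S_{a_r}` of `S_n`, for a composition
`α = (a₁, …, a_r)` of `n`: the permutations that preserve each of the consecutive blocks of
sizes `a₁, …, a_r`. -/
def parabolic {n : ℕ} (α : Composition n) : Subgroup (Equiv.Perm (Fin n)) where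
  carrier := {σ | ∀ i, α.index (σ i) = α.index i}
  mul_mem' := by
    intro σ τ hσ hτ i
    rw [Equiv.Perm.mul_apply, hσ, hτ]
  one_mem' := fun _ => rfl
  inv_mem' := by
    intro σ hσ i
    have h := hσ (σ⁻¹ i)
    have h2 : σ (σ⁻¹ i) = i := σ.apply_symm_apply i
    rw [h2] at h
    exact h.symm

/-- The set `S_β \ S_n / S_α` of double cosets. -/
abbrev DCoset {n : ℕ} (β α : Composition n) : Type :=
  DoubleCoset.Quotient (parabolic β : Set (Equiv.Perm (Fin n)))
    (parabolic α : Set (Equiv.Perm (Fin n)))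

instance {n : ℕ} (β α : Composition n) : Finite (DCoset β α) :=
  inferInstanceAs (Finite (Quotient _))

instance {n : ℕ} (β α : Composition n) : Fintype (DCoset β α) := Fintype.ofFinite _

/-- The length of a double coset: the length of its elements of minimal length. -/
def cosetLength {n : ℕ} {β α : Composition n} (c : DCoset β α) : ℕ :=
  sInf {l | ∃ σ : Equiv.Perm (Fin n),
    DoubleCoset.mk (parabolic β) (parabolic α) σ = c ∧ permLength σ = l}

/-- `∑_c q ^ ℓ(c)`, the sum over all double cosets `c` in `S_β \ S_n / S_α`. -/
def compPairing {𝕜 : Type*} [CommRing 𝕜] (q : 𝕜) {n : ℕ} (β α : Composition n) : 𝕜 :=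
  ∑ c : DCoset β α, q ^ cosetLength c

theorem permLength_inv {n : ℕ} (σ : Equiv.Perm (Fin n)) : permLength σ⁻¹ = permLength σ := by
  unfold permLength
  refine Finset.card_bij' (fun p _ => (σ⁻¹ p.2, σ⁻¹ p.1)) (fun p _ => (σ p.2, σ p.1)) ?_ ?_ ?_ ?_
  · simp +contextual
  · simp +contextual
  · simp
  · simp

/-- Inversion of permutations, as a bijection between double cosets. -/
def cosetInv {n : ℕ} (β α : Composition n) : DCoset β α ≃ DCoset α β where
  toFun := Quotient.map' (fun σ => σ⁻¹) (by
    intro σ τ h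
    obtain ⟨a, ha, b, hb, rfl⟩ := DoubleCoset.rel_iff.1 h
    exact DoubleCoset.rel_iff.2 ⟨b⁻¹, inv_mem hb, a⁻¹, inv_mem ha, by simp [mul_assoc]⟩)
  invFun := Quotient.map' (fun σ => σ⁻¹) (by
    intro σ τ h
    obtain ⟨a, ha, b, hb, rfl⟩ := DoubleCoset.rel_iff.1 h
    exact DoubleCoset.rel_iff.2 ⟨b⁻¹, inv_mem hb, a⁻¹, inv_mem ha, by simp [mul_assoc]⟩)
  left_inv := by
    intro c
    induction c using Quotient.inductionOn' with
    | h σ => exact congrArg _ (inv_inv σ)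
  right_inv := by
    intro c
    induction c using Quotient.inductionOn' with
    | h σ => exact congrArg _ (inv_inv σ)

theorem cosetInv_mk {n : ℕ} (β α : Composition n) (σ : Equiv.Perm (Fin n)) :
    cosetInv β α (DoubleCoset.mk (parabolic β) (parabolic α) σ) =
      DoubleCoset.mk (parabolic α) (parabolic β) σ⁻¹ := rfl

theorem cosetLength_inv {n : ℕ} (β α : Composition n) (c : DCoset β α) :
    cosetLength (cosetInv β α c) = cosetLength c := by
  unfold cosetLength
  congr 1
  ext l
  constructor
  · rintro ⟨σ, h, rfl⟩
    refine ⟨σ⁻¹, ?_, permLength_inv σ⟩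
    apply (cosetInv β α).injective
    rw [cosetInv_mk, inv_inv, h]
  · rintro ⟨σ, rfl, rfl⟩
    exact ⟨σ⁻¹, (cosetInv_mk β α σ).symm, permLength_inv σ⟩

theorem compPairing_comm {𝕜 : Type*} [CommRing 𝕜] (q : 𝕜) {n : ℕ} (β α : Composition n) :
    compPairing q β α = compPairing q α β := by
  unfold compPairing
  exact Fintype.sum_equiv (cosetInv β α) _ _ fun c => by rw [cosetLength_inv]

/-! ### The free algebra `Λ'` and its bilinear form -/

/-- `Λ'`: the free associative algebra on generators `h₁, h₂, …`. -/
abbrev FreeLambda (𝕜 : Type*) [CommRing 𝕜] : Type _ := FreeAlgebra 𝕜 ℕ+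

/-- The degree `a₁ + ⋯ + a_r` of the word `h_{a₁} ⋯ h_{a_r}`. -/
def wordDegree (w : FreeMonoid ℕ+) : ℕ := (w.toList.map fun a : ℕ+ => (a : ℕ)).sum

/-- The composition `(a₁, …, a_r)` of `n` given by a word `h_{a₁} ⋯ h_{a_r}` of degree `n`. -/
def wordComp (w : FreeMonoid ℕ+) {n : ℕ} (hw : wordDegree w = n) : Composition n where
  blocks := w.toList.map fun a : ℕ+ => (a : ℕ)
  blocks_pos := by
    intro i hi
    obtain ⟨a, -, rfl⟩ := List.mem_map.1 hi
    exact a.pos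
  blocks_sum := hw

/-- The value `(h_β, h_α)` of the bilinear form on two words: `∑_c q ^ ℓ(c)` over the double
cosets in `S_β \ S_n / S_α` if `|β| = |α| = n`, and zero if `|β| ≠ |α|`. -/
def wordPairing {𝕜 : Type*} [CommRing 𝕜] (q : 𝕜) (v w : FreeMonoid ℕ+) : 𝕜 :=
  if h : wordDegree v = wordDegree w then compPairing q (wordComp v h) (wordComp w rfl) else 0

theorem wordPairing_comm {𝕜 : Type*} [CommRing 𝕜] (q : 𝕜) (v w : FreeMonoid ℕ+) :
    wordPairing q v w = wordPairing q w v := by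
  have key : ∀ (v w : FreeMonoid ℕ+) (n : ℕ) (hv : wordDegree v = n) (hw : wordDegree w = n),
      wordPairing q v w = compPairing q (wordComp v hv) (wordComp w hw) := by
    intro v w n hv hw
    subst hw
    simp [wordPairing, hv]
  by_cases h : wordDegree v = wordDegree w
  · rw [key v w _ h rfl, key w v _ rfl h, compPairing_comm]
  · rw [wordPairing, wordPairing, dif_neg h, dif_neg (Ne.symm h)]

/-- The bilinear form on `Λ'` with `(h_β, h_α) = ∑_c q ^ ℓ(c)`. -/
def freeForm {𝕜 : Type*} [CommRing 𝕜] (q : 𝕜) : LinearMap.BilinForm 𝕜 (FreeLambda 𝕜) :=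
  (FreeAlgebra.basisFreeMonoid 𝕜 ℕ+).constr 𝕜 fun v =>
    (FreeAlgebra.basisFreeMonoid 𝕜 ℕ+).constr 𝕜 fun w => wordPairing q v w

theorem freeForm_comm {𝕜 : Type*} [CommRing 𝕜] (q : 𝕜) (x y : FreeLambda 𝕜) :
    freeForm q x y = freeForm q y x := by
  have h : freeForm q = LinearMap.BilinForm.flip (freeForm q) := by
    refine (FreeAlgebra.basisFreeMonoid 𝕜 ℕ+).ext fun v =>
      (FreeAlgebra.basisFreeMonoid 𝕜 ℕ+).ext fun w => ?_
    rw [LinearMap.BilinForm.flip_apply]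
    simp only [freeForm, Module.Basis.constr_basis]
    exact wordPairing_comm q v w
  exact LinearMap.congr_fun₂ h x y

/-- The radical of the bilinear form: all `x` with `(x, y) = 0` for every `y`. -/
def radical {𝕜 : Type*} [CommRing 𝕜] (q : 𝕜) : Submodule 𝕜 (FreeLambda 𝕜) :=
  LinearMap.ker (freeForm q)

/-- The largest two-sided ideal contained in the radical. The radical is in fact itself a
two-sided ideal, so this is the radical; this description makes it evident that the quotient is an
algebra to which the form descends. -/
def radicalIdeal {𝕜 : Type*} [CommRing 𝕜] (q : 𝕜) : Ideal (FreeLambda 𝕜) where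
  carrier := {x | ∀ a b, a * x * b ∈ radical q}
  add_mem' := by
    intro x y hx hy a b
    rw [mul_add, add_mul]
    exact add_mem (hx a b) (hy a b)
  zero_mem' := by
    intro a b
    simp
  smul_mem' := by
    intro c x hx a b
    rw [smul_eq_mul, ← mul_assoc]
    exact hx (a * c) b

instance {𝕜 : Type*} [CommRing 𝕜] (q : 𝕜) : (radicalIdeal q).IsTwoSided where
  mul_mem_of_left := by
    intro x c hx a b
    rw [← mul_assoc, mul_assoc (a * x)]
    exact hx a (c * b)

theorem radicalIdeal_le {𝕜 : Type*} [CommRing 𝕜] (q : 𝕜) (x : FreeLambda 𝕜)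
    (hx : x ∈ radicalIdeal q) : x ∈ radical q := by
  simpa using hx 1 1

/-! ### The algebra of odd symmetric functions -/

/-- `Λ = Λ^{-1}`, the algebra of odd symmetric functions: the quotient of `Λ'` by the radical of
the bilinear form with `q = -1`. -/
abbrev OddLambda (𝕜 : Type*) [CommRing 𝕜] : Type _ :=
  FreeLambda 𝕜 ⧸ radicalIdeal (-1 : 𝕜)

/-- The quotient map `Λ' → Λ`. -/
def toOdd (𝕜 : Type*) [CommRing 𝕜] : FreeLambda 𝕜 →ₐ[𝕜] OddLambda 𝕜 :=
  Ideal.Quotient.mkₐ 𝕜 (radicalIdeal (-1 : 𝕜))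

theorem freeForm_eq_of_toOdd_eq {𝕜 : Type*} [CommRing 𝕜] {x x' y y' : FreeLambda 𝕜}
    (hx : toOdd 𝕜 x = toOdd 𝕜 x') (hy : toOdd 𝕜 y = toOdd 𝕜 y') :
    freeForm (-1 : 𝕜) x y = freeForm (-1 : 𝕜) x' y' := by
  have key : ∀ {x x' : FreeLambda 𝕜}, toOdd 𝕜 x = toOdd 𝕜 x' →
      freeForm (-1 : 𝕜) x = freeForm (-1 : 𝕜) x' := by
    intro x x' h
    have h1 : x - x' ∈ radicalIdeal (-1 : 𝕜) := (Ideal.Quotient.mk_eq_mk_iff_sub_mem x x').1 h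
    have h2 := radicalIdeal_le _ _ h1
    rw [radical, LinearMap.mem_ker, map_sub, sub_eq_zero] at h2
    exact h2
  rw [key hx, freeForm_comm, key hy, freeForm_comm]

/-- The bilinear form on `Λ` induced by the form on `Λ'`. -/
def oddForm {𝕜 : Type*} [CommRing 𝕜] (x y : OddLambda 𝕜) : 𝕜 :=
  Quotient.liftOn₂' x y (fun a b => freeForm (-1 : 𝕜) a b) (by
    intro a b a' b' ha hb
    exact freeForm_eq_of_toOdd_eq (Quotient.sound' ha) (Quotient.sound' hb))

theorem oddForm_toOdd {𝕜 : Type*} [CommRing 𝕜] (x y : FreeLambda 𝕜) :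
    oddForm (toOdd 𝕜 x) (toOdd 𝕜 y) = freeForm (-1 : 𝕜) x y := rfl

/-- The homogeneous part `Λ_n`: the span of the images of the words of degree `n`. -/
def oddDegree (𝕜 : Type*) [CommRing 𝕜] (n : ℕ) : Submodule 𝕜 (OddLambda 𝕜) :=
  Submodule.span 𝕜 {x | ∃ w : FreeMonoid ℕ+, wordDegree w = n ∧
    toOdd 𝕜 (FreeAlgebra.basisFreeMonoid 𝕜 ℕ+ w) = x}

/-- The odd complete symmetric function `h_n` in `Λ`, with `h_0 = 1`. -/
def oddH (𝕜 : Type*) [CommRing 𝕜] (n : ℕ) : OddLambda 𝕜 :=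
  if hn : 0 < n then toOdd 𝕜 (FreeAlgebra.ι 𝕜 (⟨n, hn⟩ : ℕ+)) else 1

/-- `h_λ = h_{λ₁} h_{λ₂} ⋯` for a partition `λ = (λ₁ ≥ λ₂ ≥ ⋯)`. -/
def oddHPart (𝕜 : Type*) [CommRing 𝕜] {n : ℕ} (lam : n.Partition) : OddLambda 𝕜 :=
  ((lam.parts.sort (· ≥ ·)).map (oddH 𝕜)).prod

/-- The family `m = (m_μ)_{μ ⊢ n}` in `Λ_n` is dual to the family `(h_λ)_{λ ⊢ n}`:
`(h_λ, m_μ) = δ_{λ μ}`. -/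
def IsOddMonomial {𝕜 : Type*} [CommRing 𝕜] {n : ℕ} (m : n.Partition → OddLambda 𝕜) : Prop :=
  (∀ μ, m μ ∈ oddDegree 𝕜 n) ∧
    ∀ lam μ, oddForm (oddHPart 𝕜 lam) (m μ) = if lam = μ then 1 else 0

/-- The odd monomial symmetric functions `(m_μ)_{μ ⊢ n}`: the family dual to `(h_λ)_{λ ⊢ n}`. -/
def oddMonomial (𝕜 : Type*) [CommRing 𝕜] (n : ℕ) : n.Partition → OddLambda 𝕜 :=
  Classical.epsilon IsOddMonomial

/-- The odd power symmetric function `p_k = m_{(k)}`. -/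
def oddPower (𝕜 : Type*) [CommRing 𝕜] (k : ℕ) : OddLambda 𝕜 :=
  oddMonomial 𝕜 k (Nat.Partition.indiscrete k)

end

end OddSymm

/-! A double coset in S_β\S_n/S_α is the same thing as a matrix of natural numbers with row sums β
and column sums α, and its minimal length counts the pairs of units in south-west to north-east
position. Stripping the first row of such matrices exhibits the adjoint D_c (`freeD`) of left
multiplication by h_c: one has D_c h_m = h_{m-c} and the signed Leibniz rule D_c(xy) = ∑_{i+j=c}
σ^j(D_i x) D_j y, with σ the parity automorphism (`freeForm_freeH_mul`). The Leibniz rule makes the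
radical a two-sided ideal, and an element of Λ vanishes once the counit and all D_c with c > 0 kill
it (`eq_zero_of_oddD`).

The structure of Λ comes from a second family E_c (`freeE`), linked to the D_c by an analogue of ∑ ±
e_k h_{n-k} = 0 (`sum_freeD_freeE`). The E_c with c > 0 detect zero just as well, but only E_1 and
E_2 can be nonzero, for c > 0, on a product of two generators. This yields the quadratic relations
by induction on degree (`oddHZ_relations`), hence spanning by the h_λ. Moreover E_r strips the first
column from h_λ with r parts, which gives linear independence. Nondegeneracy then provides the dual
family.

For even k > 0, p_k is primitive: D_k p_k = 1 and D_c p_k = 0 for all other c > 0. By adjunction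
this says that straightening h_c h_l in degree k with 0 < c < k never produces h_k. Indeed h_k alone
could only arise from a two-letter word, and two letters of even total degree simply commute
(`oddH_mul_mem_partSpan_two`). The Leibniz rule and induction on m then give h_m p_k = p_k h_m. For
odd k, applying D_{k+1} to h_2 p_k - p_k h_2 gives -2 h_1, which is nonzero. -/

namespace OddSymm

open Finset

/-! ### Double cosets as matrices -/

theorem exists_equiv_of_card_fiber_eq {X Y J : Type*} [Fintype X] [Fintype Y] [DecidableEq J]
    (f : X → J) (g : Y → J)
    (h : ∀ j, (univ.filter fun x => f x = j).card = (univ.filter fun y => g y = j).card) :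
    ∃ e : X ≃ Y, ∀ x, g (e x) = f x := by
  have h' : ∀ j, Nonempty ({x // f x = j} ≃ {y // g y = j}) := fun j =>
    ⟨Fintype.equivOfCardEq (by rw [Fintype.card_subtype, Fintype.card_subtype, h j])⟩
  exact ⟨Equiv.ofFiberEquiv fun j => (h' j).some, Equiv.ofFiberEquiv_map _⟩

theorem card_index_fiber {n : ℕ} (α : Composition n) (j : Fin α.length) :
    (univ.filter fun x => α.index x = j).card = α.blocksFun j := by
  rw [← Fintype.card_subtype]
  have e : {x // α.index x = j} ≃ Fin (α.blocksFun j) :=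
    (α.blocksFinEquiv.symm.subtypeEquiv (q := fun p => p.1 = j) fun x => Iff.rfl).trans
      (Equiv.sigmaSubtype j)
  rw [Fintype.card_congr e, Fintype.card_fin]

theorem index_monotone {n : ℕ} (α : Composition n) : Monotone α.index := by
  intro x y hxy
  by_contra h
  have h1 : ((α.index y).succ : ℕ) ≤ α.index x := Nat.succ_le_of_lt (not_le.1 h)
  have h2 := α.monotone_sizeUpTo h1
  have h3 := α.lt_sizeUpTo_index_succ y
  have h4 := α.sizeUpTo_index_le x
  have h5 : (x : ℕ) ≤ y := hxy
  omega

/-- The number of entries `x` with `σ` sending `x` from block `j` of `α` to block `i` of `β`. -/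
def permMatrix {n : ℕ} (β α : Composition n) (σ : Equiv.Perm (Fin n)) :
    Fin β.length → Fin α.length → ℕ :=
  fun i j => (univ.filter fun x => β.index (σ x) = i ∧ α.index x = j).card

/-- The matrices with given row sums and column sums. -/
def marginMatrices {r s : ℕ} (b : Fin r → ℕ) (a : Fin s → ℕ) : Finset (Fin r → Fin s → ℕ) :=
  (Fintype.piFinset fun i => piAntidiag univ (b i)).filter fun A => ∀ j, ∑ i, A i j = a j

theorem mem_marginMatrices {r s : ℕ} {b : Fin r → ℕ} {a : Fin s → ℕ} {A : Fin r → Fin s → ℕ} :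
    A ∈ marginMatrices b a ↔ (∀ i, ∑ j, A i j = b i) ∧ ∀ j, ∑ i, A i j = a j := by
  simp [marginMatrices]

/-- The sum of products of pairs of entries in south-west to north-east position. -/
def matrixInv {r s : ℕ} (A : Fin r → Fin s → ℕ) : ℕ :=
  ∑ i, ∑ i', ∑ j, ∑ j', if i < i' ∧ j' < j then A i j * A i' j' else 0

theorem permMatrix_mem {n : ℕ} (β α : Composition n) (σ : Equiv.Perm (Fin n)) :
    permMatrix β α σ ∈ marginMatrices β.blocksFun α.blocksFun := by
  rw [mem_marginMatrices]
  constructor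
  · intro i
    rw [← card_index_fiber β i]
    have : (univ.filter fun x => β.index x = i).card
        = (univ.filter fun x => β.index (σ x) = i).card := by
      refine (Finset.card_equiv σ fun x => ?_).symm
      simp
    rw [this, Finset.card_eq_sum_card_fiberwise (f := α.index) (t := univ) (by simp)]
    refine Finset.sum_congr rfl fun j _ => ?_
    rw [permMatrix, Finset.filter_filter]
  · intro j
    rw [← card_index_fiber α j,
      Finset.card_eq_sum_card_fiberwise (f := fun x => β.index (σ x)) (t := univ) (by simp)]
    refine Finset.sum_congr rfl fun i _ => ?_
    rw [permMatrix, Finset.filter_filter]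
    simp only [and_comm]

/-- Equal matrices allow a bijection `π` of positions matching the (row, column) labels of `τ` with
those of `σ`. It preserves the α-blocks, and the discrepancy `τ * π⁻¹ * σ⁻¹` preserves the β-blocks.
-/
theorem mk_eq_iff_permMatrix {n : ℕ} (β α : Composition n) (σ τ : Equiv.Perm (Fin n)) :
    (DoubleCoset.mk (parabolic β) (parabolic α) σ : DCoset β α) = DoubleCoset.mk _ _ τ ↔
      permMatrix β α σ = permMatrix β α τ := by
  rw [DoubleCoset.eq]
  constructor
  · rintro ⟨b, hb, a, ha, rfl⟩
    funext i j
    refine (Finset.card_equiv a fun x => ?_).symm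
    have h1 := hb (σ (a x))
    have h2 := ha x
    simp only [mem_filter, mem_univ, true_and]
    simp only [Equiv.Perm.mul_apply, h1, h2]
  · intro h
    obtain ⟨π, hπ⟩ := exists_equiv_of_card_fiber_eq
      (fun x => (β.index (τ x), α.index x)) (fun x => (β.index (σ x), α.index x)) (by
        rintro ⟨i, j⟩
        have := congrFun (congrFun h i) j
        simpa only [Prod.mk.injEq, permMatrix] using this.symm)
    simp only [Prod.mk.injEq] at hπ
    refine ⟨τ * π⁻¹ * σ⁻¹, ?_, π, fun x => (hπ x).2, ?_⟩
    · intro x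
      have := (hπ (π⁻¹ (σ⁻¹ x))).1
      simpa using this.symm
    · simp [mul_assoc]

/-- These are the inversions forced by the double coset: those between different blocks on both the
source and the target side. They bound the length from below. -/
theorem matrixInv_permMatrix {n : ℕ} (β α : Composition n) (σ : Equiv.Perm (Fin n)) :
    matrixInv (permMatrix β α σ) = (univ.filter fun p : Fin n × Fin n =>
      α.index p.1 < α.index p.2 ∧ β.index (σ p.2) < β.index (σ p.1)).card := by
  have key : ∀ (i i' : Fin β.length) (j j' : Fin α.length),
      (if i < i' ∧ j' < j then permMatrix β α σ i j * permMatrix β α σ i' j' else 0) =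
      (univ.filter fun p : Fin n × Fin n =>
        (α.index p.1 < α.index p.2 ∧ β.index (σ p.2) < β.index (σ p.1)) ∧
        ((β.index (σ p.2), β.index (σ p.1)), (α.index p.2, α.index p.1)) =
          ((i, i'), (j, j'))).card := by
    intro i i' j j'
    split_ifs with h
    · rw [permMatrix, permMatrix, mul_comm, ← Finset.card_product]
      congr 1
      ext ⟨x, y⟩
      simp only [mem_product, mem_filter, mem_univ, true_and, Prod.mk.injEq]
      constructor
      · rintro ⟨⟨rfl, rfl⟩, rfl, rfl⟩
        exact ⟨⟨h.2, h.1⟩, ⟨rfl, rfl⟩, rfl, rfl⟩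
      · rintro ⟨-, ⟨rfl, rfl⟩, rfl, rfl⟩
        exact ⟨⟨rfl, rfl⟩, rfl, rfl⟩
    · symm
      rw [Finset.card_eq_zero, Finset.filter_eq_empty_iff]
      rintro ⟨x, y⟩ - ⟨h1, h2⟩
      simp only [Prod.mk.injEq] at h2
      obtain ⟨⟨rfl, rfl⟩, rfl, rfl⟩ := h2
      exact h ⟨h1.2, h1.1⟩
  rw [Finset.card_eq_sum_card_fiberwise
    (f := fun p : Fin n × Fin n =>
      ((β.index (σ p.2), β.index (σ p.1)), (α.index p.2, α.index p.1))) (t := univ) (by simp)]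
  rw [matrixInv, Fintype.sum_prod_type, Fintype.sum_prod_type]
  refine Finset.sum_congr rfl fun i _ => Finset.sum_congr rfl fun i' _ => ?_
  rw [Fintype.sum_prod_type]
  refine Finset.sum_congr rfl fun j _ => Finset.sum_congr rfl fun j' _ => ?_
  rw [key, Finset.filter_filter]

theorem matrixInv_le_permLength {n : ℕ} (β α : Composition n) (σ : Equiv.Perm (Fin n)) :
    matrixInv (permMatrix β α σ) ≤ permLength σ := by
  rw [matrixInv_permMatrix, permLength]
  refine Finset.card_le_card fun p hp => ?_
  simp only [mem_filter, mem_univ, true_and] at hp ⊢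
  exact ⟨(index_monotone α).reflect_lt hp.1, (index_monotone β).reflect_lt hp.2⟩

/-- Sorted rearrangements are unique; this is used to see that a sorting permutation respects the
blocks. -/
theorem eq_comp_of_monotone {n r : ℕ} {f : Fin n → Fin r} {σ : Equiv.Perm (Fin n)}
    (hf : Monotone f) (hσ : Monotone (f ∘ σ)) : f ∘ σ = f := by
  have := Tuple.unique_monotone (f := f) (σ := σ) (τ := 1) hσ hf
  simpa using this

/-- A representative with only forced inversions: reorder each α-block so that the target blocks
increase along it, then number the positions inside each target block from left to right. -/
theorem exists_permLength_le {n : ℕ} (β α : Composition n) (σ₀ : Equiv.Perm (Fin n)) :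
    ∃ σ, permMatrix β α σ = permMatrix β α σ₀ ∧
      permLength σ ≤ matrixInv (permMatrix β α σ₀) := by
  set key : Fin n → Fin α.length ×ₗ Fin β.length :=
    fun x => toLex (α.index x, β.index (σ₀ x)) with hkey
  set π := Tuple.sort key with hπ
  have hmono : Monotone (key ∘ π) := Tuple.monotone_sort key
  have hα : ∀ x, α.index (π x) = α.index x := by
    have : Monotone (α.index ∘ π) := fun x y hxy => by
      have := hmono hxy
      simp only [hkey, Function.comp, Prod.Lex.toLex_le_toLex] at this
      rcases this with h | h
      · exact h.le
      · exact h.1.le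
    exact fun x => congrFun (eq_comp_of_monotone (index_monotone α) this) x
  set g : Fin n → Fin β.length := fun x => β.index (σ₀ (π x)) with hg
  have hgm : ∀ x y, x ≤ y → α.index x = α.index y → g x ≤ g y := fun x y hxy he => by
    have := hmono hxy
    simp only [hkey, Function.comp, Prod.Lex.toLex_le_toLex, hα, he, lt_irrefl, true_and,
      false_or] at this
    exact this
  -- The sort is stable, so `τ⁻¹` keeps the order of positions with equal `g`. An inversion of `τ⁻¹`
  -- therefore forces a strict descent of `g`, which cannot occur inside one α-block.
  set τ := Tuple.sort g with hτ
  obtain ⟨hτ1, hτ2⟩ := Tuple.eq_sort_iff.1 hτ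
  have hβ : ∀ x, g (τ x) = β.index x := by
    have h1 : g ∘ τ = β.index ∘ (σ₀ * π * τ : Equiv.Perm (Fin n)) := rfl
    rw [h1] at hτ1
    exact fun x => congrFun (eq_comp_of_monotone (index_monotone β) hτ1) x
  have hβ' : ∀ x, β.index (τ⁻¹ x) = g x := fun x => by rw [← hβ]; simp
  have hmat : permMatrix β α τ⁻¹ = permMatrix β α σ₀ := by
    funext i j
    refine Finset.card_equiv π fun x => ?_
    simp only [mem_filter, mem_univ, true_and, hβ', hα, hg]
  refine ⟨τ⁻¹, hmat, ?_⟩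
  rw [← hmat, matrixInv_permMatrix, permLength]
  refine Finset.card_le_card ?_
  rintro ⟨x, y⟩ hp
  simp only [mem_filter, mem_univ, true_and, hβ'] at hp ⊢
  obtain ⟨hxy, hyx⟩ := hp
  have h1 : g y ≤ g x := by
    have := hτ1 hyx.le
    simpa using this
  have h2 : g y < g x := by
    refine lt_of_le_of_ne h1 fun h => ?_
    have := hτ2 _ _ hyx (by simpa using h)
    simp only [← Equiv.Perm.mul_apply, mul_inv_cancel, Equiv.Perm.one_apply] at this
    exact absurd hxy this.not_gt
  refine ⟨lt_of_le_of_ne (index_monotone α hxy.le) fun h => ?_, h2⟩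
  exact absurd (hgm x y hxy.le h) h2.not_ge

theorem cosetLength_mk {n : ℕ} (β α : Composition n) (σ : Equiv.Perm (Fin n)) :
    cosetLength (DoubleCoset.mk (parabolic β) (parabolic α) σ : DCoset β α) =
      matrixInv (permMatrix β α σ) := by
  obtain ⟨τ, hτ, hle⟩ := exists_permLength_le β α σ
  unfold cosetLength
  apply le_antisymm
  · refine le_trans (Nat.sInf_le ?_) hle
    exact ⟨τ, (mk_eq_iff_permMatrix β α τ σ).2 hτ, rfl⟩
  · refine le_csInf (s := {l | ∃ τ : Equiv.Perm (Fin n),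
      (DoubleCoset.mk (parabolic β) (parabolic α) τ : DCoset β α) = DoubleCoset.mk _ _ σ ∧
        permLength τ = l}) ⟨permLength σ, σ, rfl, rfl⟩ ?_
    rintro l ⟨ρ, hρ, rfl⟩
    rw [← (mk_eq_iff_permMatrix β α ρ σ).1 hρ]
    exact matrixInv_le_permLength β α ρ

theorem exists_permMatrix_eq {n : ℕ} (β α : Composition n) (A : Fin β.length → Fin α.length → ℕ)
    (hA : A ∈ marginMatrices β.blocksFun α.blocksFun) : ∃ σ, permMatrix β α σ = A := by
  rw [mem_marginMatrices] at hA
  -- One token for each unit of each entry. Numbering the tokens compatibly with the columns (`u`)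
  -- and with the rows (`v`) and comparing the two numberings gives the permutation.
  let X := Σ p : Fin β.length × Fin α.length, Fin (A p.1 p.2)
  have hfib : ∀ (P : Fin β.length × Fin α.length → Prop) [DecidablePred P],
      (univ.filter fun x : X => P x.1).card = ∑ p, if P p then A p.1 p.2 else 0 := by
    intro P _
    rw [Finset.card_filter, Fintype.sum_sigma]
    refine Finset.sum_congr rfl fun p _ => ?_
    split_ifs <;> simp
  obtain ⟨u, hu⟩ := exists_equiv_of_card_fiber_eq (fun x : X => x.1.2) α.index (fun j => by
    rw [card_index_fiber, ← hA.2 j, hfib fun p => p.2 = j, Fintype.sum_prod_type]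
    simp)
  obtain ⟨v, hv⟩ := exists_equiv_of_card_fiber_eq (fun x : X => x.1.1) β.index (fun i => by
    rw [card_index_fiber, ← hA.1 i, hfib fun p => p.1 = i, Fintype.sum_prod_type_right]
    simp)
  refine ⟨u.symm.trans v, ?_⟩
  funext i j
  have h1 : permMatrix β α (u.symm.trans v) i j
      = (univ.filter fun x : X => x.1.1 = i ∧ x.1.2 = j).card := by
    refine (Finset.card_equiv u fun x => ?_).symm
    simp [hu, hv]
  rw [h1, hfib fun p => p.1 = i ∧ p.2 = j, Fintype.sum_prod_type, Finset.sum_eq_single i,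
    Finset.sum_eq_single j] <;> simp +contextual

theorem compPairing_eq_sum_matrices {𝕜 : Type*} [CommRing 𝕜] (q : 𝕜) {n : ℕ}
    (β α : Composition n) :
    compPairing q β α = ∑ A ∈ marginMatrices β.blocksFun α.blocksFun, q ^ matrixInv A := by
  unfold compPairing
  have hlift : ∀ σ τ : Equiv.Perm (Fin n),
      (DoubleCoset.setoid (parabolic β : Set (Equiv.Perm (Fin n))) (parabolic α)) σ τ →
      permMatrix β α σ = permMatrix β α τ := fun σ τ h =>
    (mk_eq_iff_permMatrix β α σ τ).1 (Quotient.sound h)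
  refine Finset.sum_bij (fun c _ => Quotient.lift (permMatrix β α) hlift c) ?_ ?_ ?_ ?_
  · intro c _
    induction c using Quotient.inductionOn with
    | h σ => exact permMatrix_mem β α σ
  · intro c _ d _
    induction c using Quotient.inductionOn with
    | h σ =>
      induction d using Quotient.inductionOn with
      | h τ => exact (mk_eq_iff_permMatrix β α σ τ).2
  · intro A hA
    obtain ⟨σ, hσ⟩ := exists_permMatrix_eq β α A hA
    exact ⟨DoubleCoset.mk _ _ σ, Finset.mem_univ _, hσ⟩
  · intro c _
    induction c using Quotient.inductionOn with
    | h σ => exact congrArg _ (cosetLength_mk β α σ)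

end OddSymm

namespace OddSymm

open Finset

noncomputable section

variable {𝕜 : Type*} [CommRing 𝕜]

/-! ### Twisted derivations of the free algebra -/

/-- The generator `h_n` of `Λ'`, with `h_0 = 1`. -/
def freeH (𝕜 : Type*) [CommRing 𝕜] (n : ℕ) : FreeLambda 𝕜 :=
  if hn : 0 < n then FreeAlgebra.ι 𝕜 (⟨n, hn⟩ : ℕ+) else 1

@[simp] theorem freeH_zero : freeH 𝕜 0 = 1 := by simp [freeH]

theorem freeH_coe (m : ℕ+) : freeH 𝕜 (m : ℕ) = FreeAlgebra.ι 𝕜 m := by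
  rw [freeH, dif_pos m.pos]
  rfl

/-- The parity automorphism `h_n ↦ (-1) ^ n h_n` of `Λ'`. -/
def freeSign (𝕜 : Type*) [CommRing 𝕜] : FreeLambda 𝕜 →ₐ[𝕜] FreeLambda 𝕜 :=
  FreeAlgebra.lift 𝕜 fun m : ℕ+ => (-1 : 𝕜) ^ (m : ℕ) • FreeAlgebra.ι 𝕜 m

theorem freeSign_freeH (n : ℕ) : freeSign 𝕜 (freeH 𝕜 n) = (-1 : 𝕜) ^ n • freeH 𝕜 n := by
  rcases Nat.eq_zero_or_pos n with rfl | hn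
  · simp
  · lift n to ℕ+ using hn
    rw [freeH_coe]
    simp [freeSign]

theorem freeSign_pow_freeH (n j : ℕ) :
    (freeSign 𝕜 ^ j) (freeH 𝕜 n) = (-1 : 𝕜) ^ (n * j) • freeH 𝕜 n := by
  induction j with
  | zero => simp
  | succ j ih =>
    rw [pow_succ', AlgHom.mul_apply, ih, map_smul, freeSign_freeH, smul_smul, ← pow_add,
      Nat.mul_succ]

/-- The product `(∑ f_i s ^ i) (∑ g_j s ^ j)` of power series over `Λ'` in a variable `s` with
`s x = freeSign x s`. -/
def skewMul (f : ℕ → FreeLambda 𝕜) : (ℕ → FreeLambda 𝕜) →ₗ[𝕜] (ℕ → FreeLambda 𝕜) where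
  toFun g c := ∑ p ∈ antidiagonal c, (freeSign 𝕜 ^ p.2) (f p.1) * g p.2
  map_add' g g' := by
    funext c
    simp [mul_add, Finset.sum_add_distrib]
  map_smul' a g := by
    funext c
    simp [Finset.smul_sum]

theorem skewMul_apply (f g : ℕ → FreeLambda 𝕜) (c : ℕ) :
    skewMul f g c = ∑ p ∈ antidiagonal c, (freeSign 𝕜 ^ p.2) (f p.1) * g p.2 := rfl

theorem skewMul_assoc (f g h : ℕ → FreeLambda 𝕜) :
    skewMul (skewMul f g) h = skewMul f (skewMul g h) := by
  funext c
  simp only [skewMul_apply, map_sum, map_mul, Finset.sum_mul, Finset.mul_sum, ← mul_assoc]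
  simp only [← AlgHom.mul_apply, ← pow_add]
  rw [Finset.sum_sigma', Finset.sum_sigma']
  refine Finset.sum_nbij' (fun x => ⟨(x.2.1, x.2.2 + x.1.2), (x.2.2, x.1.2)⟩)
    (fun x => ⟨(x.1.1 + x.2.1, x.2.2), (x.1.1, x.2.1)⟩) ?_ ?_ ?_ ?_ ?_
  · rintro ⟨⟨a, l⟩, ⟨i, k⟩⟩ hx
    simp only [mem_sigma, HasAntidiagonal.mem_antidiagonal, and_true] at hx ⊢
    omega
  · rintro ⟨⟨a, l⟩, ⟨i, k⟩⟩ hx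
    simp only [mem_sigma, HasAntidiagonal.mem_antidiagonal, and_true] at hx ⊢
    omega
  · rintro ⟨⟨a, l⟩, ⟨i, k⟩⟩ hx
    simp only [mem_sigma, HasAntidiagonal.mem_antidiagonal] at hx ⊢
    obtain ⟨-, rfl⟩ := hx
    rfl
  · rintro ⟨⟨a, l⟩, ⟨i, k⟩⟩ hx
    simp only [mem_sigma, HasAntidiagonal.mem_antidiagonal] at hx ⊢
    obtain ⟨-, rfl⟩ := hx
    rfl
  · rintro ⟨⟨a, l⟩, ⟨i, k⟩⟩ _
    simp only [add_comm]

/-- The unit for `skewMul`. -/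
def skewOne : ℕ → FreeLambda 𝕜 := Pi.single 0 1

theorem skewOne_apply (c : ℕ) : (skewOne c : FreeLambda 𝕜) = if c = 0 then 1 else 0 := by
  simp [skewOne, Pi.single_apply]

theorem skewMul_one (f : ℕ → FreeLambda 𝕜) : skewMul f skewOne = f := by
  funext c
  rw [skewMul_apply, Finset.sum_eq_single (c, 0)]
  · simp [skewOne_apply]
  · rintro ⟨i, j⟩ h1 h2
    have : j ≠ 0 := by
      rintro rfl
      exact h2 (by simpa using h1)
    simp [skewOne_apply, this]
  · simp

theorem one_skewMul (f : ℕ → FreeLambda 𝕜) : skewMul skewOne f = f := by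
  funext c
  rw [skewMul_apply, Finset.sum_eq_single (0, c)]
  · simp [skewOne_apply]
  · rintro ⟨i, j⟩ h1 h2
    have : i ≠ 0 := by
      rintro rfl
      exact h2 (by simpa using h1)
    simp [skewOne_apply, this]
  · simp

/-- The linear maps `∂_0, ∂_1, …` on `Λ'` with prescribed values on generators and
`∂_c (x y) = ∑_{i + j = c} freeSign ^ j (∂_i x) ∂_j y`. -/
def skewDer (f : ℕ+ → ℕ → FreeLambda 𝕜) (c : ℕ) : FreeLambda 𝕜 →ₗ[𝕜] FreeLambda 𝕜 where
  -- The Leibniz rule says that x ↦ ∑ ∂_c(x) s^c is multiplicative into the skew power series. Each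
  -- generator thus acts by left multiplication by its prescribed series, freeness extends the
  -- action, and evaluating at the unit series recovers the coefficients.
  toFun x := FreeAlgebra.lift 𝕜 (A := Module.End 𝕜 (ℕ → FreeLambda 𝕜))
    (fun m => skewMul (f m)) x skewOne c
  map_add' x y := by simp
  map_smul' a x := by simp

theorem skewDer_apply (f : ℕ+ → ℕ → FreeLambda 𝕜) (c : ℕ) (x : FreeLambda 𝕜) :
    skewDer f c x = FreeAlgebra.lift 𝕜 (A := Module.End 𝕜 (ℕ → FreeLambda 𝕜))
      (fun m => skewMul (f m)) x skewOne c := rfl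

theorem skewDer_one (f : ℕ+ → ℕ → FreeLambda 𝕜) (c : ℕ) :
    skewDer f c 1 = if c = 0 then 1 else 0 := by
  simp [skewDer_apply, skewOne_apply]

theorem skewDer_ι (f : ℕ+ → ℕ → FreeLambda 𝕜) (c : ℕ) (m : ℕ+) :
    skewDer f c (FreeAlgebra.ι 𝕜 m) = f m c := by
  simp [skewDer_apply, skewMul_one]

theorem skewDer_mul (f : ℕ+ → ℕ → FreeLambda 𝕜) (c : ℕ) (x y : FreeLambda 𝕜) :
    skewDer f c (x * y) =
      ∑ p ∈ antidiagonal c, (freeSign 𝕜 ^ p.2) (skewDer f p.1 x) * skewDer f p.2 y := by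
  have key : ∀ x g, FreeAlgebra.lift 𝕜 (A := Module.End 𝕜 (ℕ → FreeLambda 𝕜))
      (fun m => skewMul (f m)) x g = skewMul (fun i => skewDer f i x) g := by
    intro x
    induction x using FreeAlgebra.induction with
    | grade0 r =>
      intro g
      have : (fun i => skewDer f i (algebraMap 𝕜 (FreeLambda 𝕜) r)) = r • skewOne := by
        funext i
        simp [skewDer_apply]
      rw [this]
      have h2 : skewMul (r • skewOne) g = r • skewMul skewOne g := by
        funext c
        simp [skewMul_apply, Finset.smul_sum]
      rw [h2, one_skewMul]
      simp
    | grade1 m =>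
      intro g
      simp only [skewDer_ι, FreeAlgebra.lift_ι_apply]
    | mul a b ha hb =>
      intro g
      rw [map_mul, Module.End.mul_apply, hb, ha, ← skewMul_assoc]
      congr 2
      funext i
      rw [skewDer_apply, map_mul, Module.End.mul_apply, ha]
      rfl
    | add a b ha hb =>
      intro g
      rw [map_add, LinearMap.add_apply, ha, hb]
      funext c
      simp [skewMul_apply, add_mul, Finset.sum_add_distrib]
  rw [skewDer_apply, map_mul, Module.End.mul_apply, key]
  rfl

/-- Adjoint of left multiplication by the complete functions: `∂_c h_m = h_{m - c}`. -/
def freeD (𝕜 : Type*) [CommRing 𝕜] : ℕ → FreeLambda 𝕜 →ₗ[𝕜] FreeLambda 𝕜 :=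
  skewDer fun m c => if c ≤ (m : ℕ) then freeH 𝕜 (m - c) else 0

/-- Adjoint of left multiplication by the elementary functions: `∂_0 h_m = h_m`,
`∂_1 h_m = h_{m - 1}` and `∂_c h_m = 0` for `c > 1`. -/
def freeE (𝕜 : Type*) [CommRing 𝕜] : ℕ → FreeLambda 𝕜 →ₗ[𝕜] FreeLambda 𝕜 :=
  skewDer fun m c => if c ≤ 1 then freeH 𝕜 (m - c) else 0

theorem freeD_freeH (m c : ℕ) :
    freeD 𝕜 c (freeH 𝕜 m) = if c ≤ m then freeH 𝕜 (m - c) else 0 := by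
  rcases Nat.eq_zero_or_pos m with rfl | hm
  · rcases Nat.eq_zero_or_pos c with rfl | hc
    · simp [freeD, skewDer_one]
    · simp [freeD, skewDer_one, hc.ne']
  · lift m to ℕ+ using hm
    rw [freeH_coe, freeD, skewDer_ι]

theorem freeE_freeH (m c : ℕ) :
    freeE 𝕜 c (freeH 𝕜 m) = if c ≤ 1 ∧ c ≤ m then freeH 𝕜 (m - c) else 0 := by
  rcases Nat.eq_zero_or_pos m with rfl | hm
  · rcases Nat.eq_zero_or_pos c with rfl | hc
    · simp [freeE, skewDer_one]
    · simp [freeE, skewDer_one, hc.ne']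
  · lift m to ℕ+ using hm
    have : ∀ c : ℕ, (c ≤ 1 ∧ c ≤ (m : ℕ)) ↔ c ≤ 1 := fun c =>
      ⟨fun h => h.1, fun h => ⟨h, h.trans m.2⟩⟩
    rw [freeH_coe, freeE, skewDer_ι]
    simp only [this]

theorem freeD_mul (c : ℕ) (x y : FreeLambda 𝕜) :
    freeD 𝕜 c (x * y) =
      ∑ p ∈ antidiagonal c, (freeSign 𝕜 ^ p.2) (freeD 𝕜 p.1 x) * freeD 𝕜 p.2 y :=
  skewDer_mul _ c x y

theorem freeE_mul (c : ℕ) (x y : FreeLambda 𝕜) :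
    freeE 𝕜 c (x * y) =
      ∑ p ∈ antidiagonal c, (freeSign 𝕜 ^ p.2) (freeE 𝕜 p.1 x) * freeE 𝕜 p.2 y :=
  skewDer_mul _ c x y

theorem freeD_one (c : ℕ) : freeD 𝕜 c 1 = if c = 0 then 1 else 0 := skewDer_one _ c

theorem freeE_one (c : ℕ) : freeE 𝕜 c 1 = if c = 0 then 1 else 0 := skewDer_one _ c

theorem freeD_freeH_mul (c m : ℕ) (y : FreeLambda 𝕜) :
    freeD 𝕜 c (freeH 𝕜 m * y) = ∑ p ∈ antidiagonal c,
      if p.1 ≤ m then (-1 : 𝕜) ^ ((m - p.1) * p.2) • (freeH 𝕜 (m - p.1) * freeD 𝕜 p.2 y)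
      else 0 := by
  rw [freeD_mul]
  refine Finset.sum_congr rfl fun p _ => ?_
  rw [freeD_freeH]
  split_ifs
  · rw [freeSign_pow_freeH, smul_mul_assoc]
  · simp

/-! ### The adjunction between left multiplication and twisted derivations -/

theorem sum_cons_inv {s : ℕ} (i m : ℕ) (a b : Fin s → ℕ) :
    (∑ j : Fin (s + 1), ∑ j' : Fin (s + 1), if j' < j then
      (Fin.cons i a : Fin (s + 1) → ℕ) j * (Fin.cons m b : Fin (s + 1) → ℕ) j' else 0) =
      m * ∑ j, a j + ∑ j, ∑ j', if j' < j then a j * b j' else 0 := by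
  simp [Fin.sum_univ_succ, Finset.sum_add_distrib, Finset.mul_sum, mul_comm]

/-- The product `h_{a_1} ⋯ h_{a_s}` of a tuple, in which zeros are allowed. -/
def tupleH {s : ℕ} (a : Fin s → ℕ) : FreeLambda 𝕜 := (List.ofFn fun j => freeH 𝕜 (a j)).prod

/-- Here `d j` is the amount removed from the j-th letter, and the sign records moving it past what
remains of the letters to its left. With `d` read as the first row of a matrix this is the recursion
of `matrixSum_cons` at q = -1. -/
theorem freeD_tupleH {s : ℕ} (c : ℕ) (a : Fin s → ℕ) :
    freeD 𝕜 c (tupleH a) = ∑ d ∈ (piAntidiag univ c).filter fun d : Fin s → ℕ => ∀ j, d j ≤ a j,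
      (-1 : 𝕜) ^ (∑ j, ∑ j', if j' < j then d j * (a j' - d j') else 0) •
        tupleH fun j => a j - d j := by
  induction s generalizing c with
  | zero =>
    have h1 : tupleH a = (1 : FreeLambda 𝕜) := by simp [tupleH]
    rw [h1, freeD_one]
    rcases Nat.eq_zero_or_pos c with rfl | hc
    · rw [Finset.sum_eq_single (0 : Fin 0 → ℕ)]
      · simp [tupleH]
      · intro b _ hb
        exact absurd (Subsingleton.elim _ _) hb
      · simp
    · rw [if_neg hc.ne', Finset.sum_eq_zero]
      intro d hd
      simp at hd
      omega
  | succ s ih =>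
    have h1 : ∀ b : Fin (s + 1) → ℕ,
        tupleH b = freeH 𝕜 (b 0) * tupleH (fun j : Fin s => b j.succ) := fun b => by
      simp [tupleH, List.ofFn_succ]
    rw [h1 a, freeD_freeH_mul]
    simp only [ih, Finset.mul_sum, Finset.smul_sum]
    rw [← Finset.sum_filter, Finset.sum_sigma']
    refine Finset.sum_nbij' (fun x => (Fin.cons x.1.1 x.2 : Fin (s + 1) → ℕ))
      (fun d => ⟨(d 0, ∑ j : Fin s, d j.succ), fun j => d j.succ⟩) ?_ ?_ ?_ ?_ ?_
    · rintro ⟨⟨i, j⟩, d⟩ hx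
      simp only [mem_sigma, mem_filter, HasAntidiagonal.mem_antidiagonal, mem_piAntidiag, mem_univ, implies_true,
        and_true] at hx ⊢
      obtain ⟨⟨h1, h2⟩, h3, h4⟩ := hx
      refine ⟨by simp [Fin.sum_univ_succ, h3, h1], fun j => ?_⟩
      refine Fin.cases ?_ ?_ j
      · simpa using h2
      · simpa using h4
    · intro d hx
      simp only [mem_sigma, mem_filter, HasAntidiagonal.mem_antidiagonal, mem_piAntidiag, mem_univ, implies_true,
        and_true, true_and] at hx ⊢
      rw [Fin.sum_univ_succ] at hx
      exact ⟨⟨hx.1, hx.2 0⟩, fun j : Fin s => hx.2 j.succ⟩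
    · rintro ⟨⟨i, j⟩, d⟩ hx
      simp only [mem_sigma, mem_filter, HasAntidiagonal.mem_antidiagonal, mem_piAntidiag, mem_univ, implies_true,
        and_true] at hx ⊢
      obtain ⟨⟨h1, h2⟩, rfl, h4⟩ := hx
      simp
    · intro d _
      exact Fin.cons_self_tail d
    · rintro ⟨⟨i, j⟩, d⟩ hx
      simp only [mem_sigma, mem_filter, HasAntidiagonal.mem_antidiagonal, mem_piAntidiag, mem_univ, implies_true,
        and_true] at hx
      obtain ⟨⟨h1', h2⟩, rfl, h4⟩ := hx
      have h5 : (fun j => a j - (Fin.cons i d : Fin (s + 1) → ℕ) j) =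
          (Fin.cons (a 0 - i) fun j : Fin s => a j.succ - d j : Fin (s + 1) → ℕ) := by
        funext j
        refine Fin.cases ?_ ?_ j <;> simp
      have h6 := sum_cons_inv i (a 0 - i) d fun j => a j.succ - d j
      rw [← h5] at h6
      simp only at h6 ⊢
      rw [h6, h1 fun j => a j - (Fin.cons i d : Fin (s + 1) → ℕ) j, pow_add, ← smul_smul,
        mul_smul_comm]
      simp


/-- The sum of `q ^ matrixInv A` over the matrices `A` with given row and column sums. -/
def matrixSum (q : 𝕜) {r s : ℕ} (b : Fin r → ℕ) (a : Fin s → ℕ) : 𝕜 :=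
  ∑ A ∈ marginMatrices b a, q ^ matrixInv A

theorem matrixInv_cons {r s : ℕ} (d : Fin s → ℕ) (A : Fin r → Fin s → ℕ) :
    matrixInv (Fin.cons d A : Fin (r + 1) → Fin s → ℕ) =
      (∑ j, ∑ j', if j' < j then d j * ∑ i, A i j' else 0) + matrixInv A := by
  unfold matrixInv
  rw [Fin.sum_univ_succ]
  congr 1
  · simp only [Fin.sum_univ_succ, Fin.cons_zero, Fin.cons_succ, lt_irrefl, false_and, if_false,
      Finset.sum_const_zero, zero_add, Fin.succ_pos, true_and]
    rw [Finset.sum_comm]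
    refine Finset.sum_congr rfl fun j _ => ?_
    rw [Finset.sum_comm]
    refine Finset.sum_congr rfl fun j' _ => ?_
    split_ifs
    · rw [Finset.mul_sum]
    · simp
  · refine Finset.sum_congr rfl fun i _ => ?_
    simp [Fin.sum_univ_succ]

/-- Split off the first row `d`: the remaining rows have column sums `a - d`, so the inversions
involving the first row depend on `d` and `a` only. -/
theorem matrixSum_cons (q : 𝕜) {r s : ℕ} (c : ℕ) (b : Fin r → ℕ) (a : Fin s → ℕ) :
    matrixSum q (Fin.cons c b : Fin (r + 1) → ℕ) a =
      ∑ d ∈ (piAntidiag univ c).filter fun d : Fin s → ℕ => ∀ j, d j ≤ a j,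
        q ^ (∑ j, ∑ j', if j' < j then d j * (a j' - d j') else 0) *
          matrixSum q b fun j => a j - d j := by
  simp only [matrixSum, Finset.mul_sum]
  rw [Finset.sum_sigma']
  refine Finset.sum_nbij' (fun A => ⟨A 0, fun i => A i.succ⟩)
    (fun x => (Fin.cons x.1 x.2 : Fin (r + 1) → Fin s → ℕ)) ?_ ?_ ?_ ?_ ?_
  · intro A hA
    simp only [mem_sigma, mem_filter, mem_piAntidiag, mem_univ, implies_true, and_true,
      mem_marginMatrices, Fin.sum_univ_succ] at hA ⊢
    refine ⟨⟨hA.1 0, fun j => ?_⟩, fun i => hA.1 i.succ, fun j => ?_⟩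
    · have := hA.2 j
      omega
    · have := hA.2 j
      omega
  · rintro ⟨d, A⟩ hA
    simp only [mem_sigma, mem_filter, mem_piAntidiag, mem_univ, implies_true, and_true,
      mem_marginMatrices, Fin.sum_univ_succ, Fin.cons_zero, Fin.cons_succ] at hA ⊢
    obtain ⟨⟨h1, h2⟩, h3, h4⟩ := hA
    refine ⟨fun i => Fin.cases (by simpa using h1) (by simpa using h3) i, fun j => ?_⟩
    have := h4 j
    have := h2 j
    omega
  · intro A _
    exact Fin.cons_self_tail A
  · rintro ⟨d, A⟩ _
    rfl
  · intro A hA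
    simp only [mem_marginMatrices, Fin.sum_univ_succ (n := r)] at hA
    have h1 : ∀ j, ∑ i : Fin r, A i.succ j = a j - A 0 j := fun j => by
      have := hA.2 j
      omega
    conv_lhs => rw [← Fin.cons_self_tail A]
    rw [matrixInv_cons, pow_add]
    have htail : Fin.tail A = fun i => A i.succ := rfl
    simp only [htail, h1]

/-- The algebra map `Λ' → 𝕜` killing all generators. -/
def freeCounit (𝕜 : Type*) [CommRing 𝕜] : FreeLambda 𝕜 →ₐ[𝕜] 𝕜 :=
  FreeAlgebra.lift 𝕜 fun _ => 0

theorem freeCounit_freeH (n : ℕ) : freeCounit 𝕜 (freeH 𝕜 n) = if n = 0 then 1 else 0 := by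
  rcases Nat.eq_zero_or_pos n with rfl | hn
  · simp
  · rw [if_neg hn.ne']
    lift n to ℕ+ using hn
    rw [freeH_coe]
    simp [freeCounit]

theorem freeCounit_tupleH {s : ℕ} (a : Fin s → ℕ) :
    freeCounit 𝕜 (tupleH a) = if ∀ j, a j = 0 then 1 else 0 := by
  rw [tupleH, map_list_prod, List.map_ofFn, List.prod_ofFn]
  simp only [Function.comp, freeCounit_freeH]
  rw [Fintype.prod_ite_zero]
  simp

theorem matrixSum_zero (q : 𝕜) {s : ℕ} (b : Fin 0 → ℕ) (a : Fin s → ℕ) :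
    matrixSum q b a = if ∀ j, a j = 0 then 1 else 0 := by
  rw [matrixSum]
  split_ifs with h
  · rw [Finset.sum_eq_single (fun i => Fin.elim0 i)]
    · simp [matrixInv]
    · intro A _ hA
      exact absurd (Subsingleton.elim _ _) hA
    · intro h'
      exact absurd (mem_marginMatrices.2 ⟨fun i => Fin.elim0 i, by simp [h]⟩) h'
  · rw [Finset.sum_eq_zero]
    intro A hA
    refine absurd (fun j => ?_) h
    have := (mem_marginMatrices.1 hA).2 j
    simpa using this.symm

/-- Pairing with the word `h_{b_1} ⋯ h_{b_r}`, computed through the maps `freeD`. -/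
def listPairing (𝕜 : Type*) [CommRing 𝕜] : List ℕ → FreeLambda 𝕜 →ₗ[𝕜] 𝕜
  | [] => (freeCounit 𝕜).toLinearMap
  | c :: b => listPairing 𝕜 b ∘ₗ freeD 𝕜 c

theorem get_cons_eq (c : ℕ) (b : List ℕ) :
    (c :: b).get = (Fin.cons c b.get : Fin (b.length + 1) → ℕ) := by
  funext i
  exact Fin.cases rfl (fun _ => rfl) i

theorem listPairing_tupleH (b : List ℕ) {s : ℕ} (a : Fin s → ℕ) :
    listPairing 𝕜 b (tupleH a) = matrixSum (-1 : 𝕜) b.get a := by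
  induction b generalizing a with
  | nil => exact (freeCounit_tupleH a).trans (matrixSum_zero _ _ a).symm
  | cons c b ih =>
    rw [get_cons_eq]
    refine Eq.trans ?_ (matrixSum_cons (-1 : 𝕜) c b.get a).symm
    rw [listPairing, LinearMap.comp_apply, freeD_tupleH, map_sum]
    refine Finset.sum_congr rfl fun d _ => ?_
    rw [map_smul, ih, smul_eq_mul]

theorem compPairing_eq_matrixSum (q : 𝕜) {n : ℕ} (β α : Composition n) :
    compPairing q β α = matrixSum q β.blocksFun α.blocksFun := compPairing_eq_sum_matrices q β α

/-- The letters of a word, as natural numbers. -/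
def letters (w : FreeMonoid ℕ+) : List ℕ := w.toList.map fun a : ℕ+ => (a : ℕ)

theorem sum_letters (w : FreeMonoid ℕ+) : (letters w).sum = wordDegree w := rfl

theorem wordPairing_eq_matrixSum (q : 𝕜) (v w : FreeMonoid ℕ+) :
    wordPairing q v w = matrixSum q (letters v).get (letters w).get := by
  rw [wordPairing]
  split_ifs with h
  · exact compPairing_eq_matrixSum q _ _
  · symm
    -- The row sums and the column sums have the same total, so no matrix exists when the degrees
    -- differ.
    apply Finset.sum_eq_zero
    intro A hA
    obtain ⟨h1, h2⟩ := mem_marginMatrices.1 hA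
    refine absurd ?_ h
    have h3 : ∀ l : List ℕ, ∑ i, l.get i = l.sum := Fin.sum_univ_getElem
    rw [← sum_letters, ← sum_letters, ← h3, ← h3]
    simp only [← h1, ← h2]
    exact Finset.sum_comm

theorem basis_eq_lift (w : FreeMonoid ℕ+) :
    FreeAlgebra.basisFreeMonoid 𝕜 ℕ+ w = FreeMonoid.lift (FreeAlgebra.ι 𝕜) w := by
  have h : FreeAlgebra.basisFreeMonoid 𝕜 ℕ+ w =
      MonoidAlgebra.lift 𝕜 (FreeAlgebra 𝕜 ℕ+) (FreeMonoid ℕ+) (FreeMonoid.lift (FreeAlgebra.ι 𝕜))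
        (MonoidAlgebra.single w 1) := rfl
  rw [h, MonoidAlgebra.lift_single, one_smul]

theorem basis_eq_prod (w : FreeMonoid ℕ+) :
    FreeAlgebra.basisFreeMonoid 𝕜 ℕ+ w = ((letters w).map (freeH 𝕜)).prod := by
  rw [basis_eq_lift, FreeMonoid.lift_apply, letters, List.map_map]
  congr 2
  funext m
  exact (freeH_coe m).symm

theorem basis_eq_tupleH (w : FreeMonoid ℕ+) :
    FreeAlgebra.basisFreeMonoid 𝕜 ℕ+ w = tupleH (letters w).get := by
  rw [basis_eq_prod, tupleH]
  congr 1
  conv_lhs => rw [← List.ofFn_get (letters w), List.map_ofFn]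
  rfl

theorem freeForm_basis (v : FreeMonoid ℕ+) (x : FreeLambda 𝕜) :
    freeForm (-1 : 𝕜) (FreeAlgebra.basisFreeMonoid 𝕜 ℕ+ v) x = listPairing 𝕜 (letters v) x := by
  have h : freeForm (-1 : 𝕜) (FreeAlgebra.basisFreeMonoid 𝕜 ℕ+ v) = listPairing 𝕜 (letters v) := by
    refine (FreeAlgebra.basisFreeMonoid 𝕜 ℕ+).ext fun w => ?_
    conv_rhs => rw [basis_eq_tupleH, listPairing_tupleH]
    simp only [freeForm, Module.Basis.constr_basis]
    exact wordPairing_eq_matrixSum _ v w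
  rw [h]

theorem freeForm_one_left (x : FreeLambda 𝕜) : freeForm (-1 : 𝕜) 1 x = freeCounit 𝕜 x := by
  have h : (1 : FreeLambda 𝕜) = FreeAlgebra.basisFreeMonoid 𝕜 ℕ+ 1 := by
    rw [basis_eq_lift, map_one]
  rw [h, freeForm_basis]
  rfl

theorem freeD_zero (x : FreeLambda 𝕜) : freeD 𝕜 0 x = x := by
  induction x using FreeAlgebra.induction with
  | grade0 r => rw [Algebra.algebraMap_eq_smul_one, map_smul, freeD_one, if_pos rfl]
  | grade1 m => simp [← freeH_coe, freeD_freeH]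
  | mul a b ha hb => simp [freeD_mul, ha, hb]
  | add a b ha hb => simp [ha, hb]

/-- On a word x, prefixing the letter c composes `listPairing` with `freeD 𝕜 c` on the right;
bilinearity does the rest. -/
theorem freeForm_freeH_mul (c : ℕ) (x y : FreeLambda 𝕜) :
    freeForm (-1 : 𝕜) (freeH 𝕜 c * x) y = freeForm (-1 : 𝕜) x (freeD 𝕜 c y) := by
  rcases Nat.eq_zero_or_pos c with rfl | hc
  · rw [freeH_zero, one_mul, freeD_zero]
  · lift c to ℕ+ using hc
    suffices h : (freeForm (-1 : 𝕜)).flip y ∘ₗ LinearMap.mulLeft 𝕜 (freeH 𝕜 c) =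
        (freeForm (-1 : 𝕜)).flip (freeD 𝕜 c y) from LinearMap.congr_fun h x
    refine (FreeAlgebra.basisFreeMonoid 𝕜 ℕ+).ext fun v => ?_
    have h1 : freeH 𝕜 c * FreeAlgebra.basisFreeMonoid 𝕜 ℕ+ v =
        FreeAlgebra.basisFreeMonoid 𝕜 ℕ+ (FreeMonoid.of c * v) := by
      rw [basis_eq_lift, basis_eq_lift, map_mul, FreeMonoid.lift_eval_of, freeH_coe]
    have h2 : freeForm (-1 : 𝕜) (freeH 𝕜 c * FreeAlgebra.basisFreeMonoid 𝕜 ℕ+ v) y =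
        freeForm (-1 : 𝕜) (FreeAlgebra.basisFreeMonoid 𝕜 ℕ+ v) (freeD 𝕜 c y) := by
      rw [h1, freeForm_basis, freeForm_basis]
      rfl
    exact h2

/-- Induction on words for elements of `Λ'`. -/
theorem freeLambda_induction {P : FreeLambda 𝕜 → Prop} (one : P 1)
    (mul : ∀ (m : ℕ) x, 0 < m → P x → P (freeH 𝕜 m * x))
    (add : ∀ x y, P x → P y → P (x + y)) (smul : ∀ (r : 𝕜) x, P x → P (r • x)) (x) : P x := by
  have hw : ∀ w, P (FreeAlgebra.basisFreeMonoid 𝕜 ℕ+ w) := by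
    intro w
    rw [basis_eq_lift]
    induction w using FreeMonoid.inductionOn' with
    | one => simpa using one
    | of_mul m w ih =>
      rw [map_mul, FreeMonoid.lift_eval_of, ← freeH_coe]
      exact mul m _ m.pos ih
  have hx := (FreeAlgebra.basisFreeMonoid 𝕜 ℕ+).mem_span x
  refine Submodule.span_induction (p := fun x _ => P x) ?_ ?_ (fun x y _ _ => add x y)
    (fun r x _ => smul r x) hx
  · rintro _ ⟨w, rfl⟩
    exact hw w
  · simpa using smul 0 1 one

/-! ### Stability of the radical: it is a two-sided ideal preserved by `freeD` and `freeSign`. -/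

theorem mem_radical_iff (x : FreeLambda 𝕜) :
    x ∈ radical (-1 : 𝕜) ↔ ∀ y, freeForm (-1 : 𝕜) x y = 0 := by
  rw [radical, LinearMap.mem_ker, LinearMap.ext_iff]
  rfl

/-- An element lies in the radical if the counit and all `freeD c`, `0 < c`, send it there. -/
theorem mem_radical_of_freeD {x : FreeLambda 𝕜} (h0 : freeCounit 𝕜 x = 0)
    (h : ∀ c, 0 < c → freeD 𝕜 c x ∈ radical (-1 : 𝕜)) : x ∈ radical (-1 : 𝕜) := by
  rw [mem_radical_iff]
  intro y
  rw [freeForm_comm]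
  induction y using freeLambda_induction with
  | one => rw [freeForm_one_left, h0]
  | mul m y hm _ =>
    rw [freeForm_freeH_mul, freeForm_comm]
    exact (mem_radical_iff _).1 (h m hm) y
  | add a b ha hb => simp [ha, hb]
  | smul r a ha => simp [ha]

theorem freeCounit_of_mem_radical {x : FreeLambda 𝕜} (hx : x ∈ radical (-1 : 𝕜)) :
    freeCounit 𝕜 x = 0 := by
  rw [← freeForm_one_left, freeForm_comm]
  exact (mem_radical_iff x).1 hx 1

theorem freeD_mem_radical {x : FreeLambda 𝕜} (hx : x ∈ radical (-1 : 𝕜)) (c : ℕ) :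
    freeD 𝕜 c x ∈ radical (-1 : 𝕜) := by
  rw [mem_radical_iff]
  intro y
  rw [freeForm_comm, ← freeForm_freeH_mul, freeForm_comm]
  exact (mem_radical_iff x).1 hx _

theorem freeSign_freeSign (x : FreeLambda 𝕜) : freeSign 𝕜 (freeSign 𝕜 x) = x := by
  induction x using freeLambda_induction with
  | one => simp
  | mul m y _ h =>
    rw [map_mul, map_mul, h, freeSign_freeH, map_smul, freeSign_freeH, smul_smul, ← pow_add]
    simp
  | add a b ha hb => simp [ha, hb]
  | smul r a ha => simp [ha]

theorem freeD_freeSign (c : ℕ) (x : FreeLambda 𝕜) :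
    freeD 𝕜 c (freeSign 𝕜 x) = (-1 : 𝕜) ^ c • freeSign 𝕜 (freeD 𝕜 c x) := by
  induction x using freeLambda_induction generalizing c with
  | one =>
    rw [map_one, freeD_one]
    split_ifs with h <;> simp [h]
  | mul m y _ h =>
    rw [map_mul, freeSign_freeH, smul_mul_assoc, map_smul, freeD_freeH_mul, freeD_freeH_mul,
      map_sum, Finset.smul_sum, Finset.smul_sum]
    refine Finset.sum_congr rfl fun p hp => ?_
    rw [HasAntidiagonal.mem_antidiagonal] at hp
    split_ifs with hle
    · obtain ⟨k, rfl⟩ := Nat.exists_eq_add_of_le hle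
      simp only [h, Nat.add_sub_cancel_left, map_smul, map_mul, freeSign_freeH, mul_smul_comm,
        smul_mul_assoc, smul_smul, ← pow_add, ← hp]
      congr 1
      rw [show p.1 + p.2 + (k * p.2 + k) = (p.1 + k + (k * p.2 + p.2)) by ring]
    · simp
  | add a b ha hb => simp [ha, hb]
  | smul r a ha => rw [map_smul, map_smul, map_smul, map_smul, ha, smul_comm]

theorem freeSign_mem_radical {x : FreeLambda 𝕜} (hx : x ∈ radical (-1 : 𝕜)) :
    freeSign 𝕜 x ∈ radical (-1 : 𝕜) := by
  rw [mem_radical_iff]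
  intro y
  rw [freeForm_comm]
  induction y using freeLambda_induction generalizing x with
  | one =>
    have : (freeCounit 𝕜).comp (freeSign 𝕜) = freeCounit 𝕜 := by
      ext m
      simp [freeSign, freeCounit]
    rw [freeForm_one_left, ← AlgHom.comp_apply, this, freeCounit_of_mem_radical hx]
  | mul m y _ ih =>
    rw [freeForm_freeH_mul, freeD_freeSign, map_smul, ih (freeD_mem_radical hx m), smul_zero]
  | add a b ha hb => simp [ha hx, hb hx]
  | smul r a ha => simp [ha hx]

theorem freeSign_pow_mem_radical {x : FreeLambda 𝕜} (hx : x ∈ radical (-1 : 𝕜)) (j : ℕ) :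
    (freeSign 𝕜 ^ j) x ∈ radical (-1 : 𝕜) := by
  induction j with
  | zero => simpa using hx
  | succ j ih =>
    rw [pow_succ', AlgHom.mul_apply]
    exact freeSign_mem_radical ih

/-- Induction on the word paired against: removing its first letter applies `freeD` to the product,
and each Leibniz term again has a factor in the radical. Hence `x` and `z` must vary in the
induction. -/
theorem mul_mem_radical_left {x : FreeLambda 𝕜} (hx : x ∈ radical (-1 : 𝕜)) (z : FreeLambda 𝕜) :
    z * x ∈ radical (-1 : 𝕜) := by
  rw [mem_radical_iff]
  intro y
  rw [freeForm_comm]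
  induction y using freeLambda_induction generalizing x z with
  | one => rw [freeForm_one_left, map_mul, freeCounit_of_mem_radical hx, mul_zero]
  | mul m y _ ih =>
    rw [freeForm_freeH_mul, freeD_mul, map_sum]
    exact Finset.sum_eq_zero fun p _ => ih (freeD_mem_radical hx _) _
  | add a b ha hb => simp [ha hx, hb hx]
  | smul r a ha => simp [ha hx]

theorem mul_mem_radical_right {x : FreeLambda 𝕜} (hx : x ∈ radical (-1 : 𝕜)) (z : FreeLambda 𝕜) :
    x * z ∈ radical (-1 : 𝕜) := by
  rw [mem_radical_iff]
  intro y
  rw [freeForm_comm]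
  induction y using freeLambda_induction generalizing x z with
  | one => rw [freeForm_one_left, map_mul, freeCounit_of_mem_radical hx, zero_mul]
  | mul m y _ ih =>
    rw [freeForm_freeH_mul, freeD_mul, map_sum]
    exact Finset.sum_eq_zero fun p _ =>
      ih (freeSign_pow_mem_radical (freeD_mem_radical hx _) _) _
  | add a b ha hb => simp [ha hx, hb hx]
  | smul r a ha => simp [ha hx]

theorem toOdd_eq_zero_iff (x : FreeLambda 𝕜) : toOdd 𝕜 x = 0 ↔ x ∈ radical (-1 : 𝕜) := by
  have h : toOdd 𝕜 x = 0 ↔ x ∈ radicalIdeal (-1 : 𝕜) := Ideal.Quotient.eq_zero_iff_mem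
  rw [h]
  exact ⟨radicalIdeal_le _ x, fun hx a b => mul_mem_radical_right (mul_mem_radical_left hx a) b⟩


/-! ### Elementary operators -/

theorem freeE_zero (x : FreeLambda 𝕜) : freeE 𝕜 0 x = x := by
  induction x using FreeAlgebra.induction with
  | grade0 r => rw [Algebra.algebraMap_eq_smul_one, map_smul, freeE_one, if_pos rfl]
  | grade1 m => simp [← freeH_coe, freeE_freeH]
  | mul a b ha hb => simp [freeE_mul, ha, hb]
  | add a b ha hb => simp [ha, hb]

theorem freeD_succ_freeH_succ_mul (l m : ℕ) (z : FreeLambda 𝕜) :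
    freeD 𝕜 (l + 1) (freeH 𝕜 (m + 1) * z) =
      (-1 : 𝕜) ^ ((m + 1) * (l + 1)) • (freeH 𝕜 (m + 1) * freeD 𝕜 (l + 1) z) +
        freeD 𝕜 l (freeH 𝕜 m * z) := by
  rw [freeD_freeH_mul, Finset.Nat.sum_antidiagonal_succ, freeD_freeH_mul]
  simp

theorem freeE_succ_freeH_succ_mul (k m : ℕ) (z : FreeLambda 𝕜) :
    freeE 𝕜 (k + 1) (freeH 𝕜 (m + 1) * z) =
      (-1 : 𝕜) ^ ((m + 1) * (k + 1)) • (freeH 𝕜 (m + 1) * freeE 𝕜 (k + 1) z) +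
        (-1 : 𝕜) ^ (m * k) • (freeH 𝕜 m * freeE 𝕜 k z) := by
  rw [freeE_mul, Finset.Nat.sum_antidiagonal_succ]
  congr 1
  · simp only [freeE_zero]
    rw [freeSign_pow_freeH, smul_mul_assoc]
  · rw [Finset.sum_eq_single (0, k)]
    · simp [freeE_freeH, freeSign_pow_freeH]
    · rintro ⟨i, j⟩ h1 h2
      have : ¬ (i + 1 ≤ 1 ∧ i + 1 ≤ m + 1) := by
        rintro ⟨h3, -⟩
        obtain rfl : i = 0 := by omega
        exact h2 (by simpa using h1)
      rw [freeE_freeH, if_neg this]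
      simp
    · simp

/-- The sign `(-1) ^ (k (k + 1) / 2)`. -/
def triSign (𝕜 : Type*) [CommRing 𝕜] : ℕ → 𝕜
  | 0 => 1
  | k + 1 => (-1) ^ (k + 1) * triSign 𝕜 k

theorem triSign_mul_self (k : ℕ) : triSign 𝕜 k * triSign 𝕜 k = 1 := by
  induction k with
  | zero => simp [triSign]
  | succ k ih =>
    rw [triSign, mul_mul_mul_comm, ih, ← pow_add, ← two_mul]
    simp

/-- The odd analogue of ∑ (-1)^k e_k h_{n-k} = 0. In front of a generator h_{m+1} both families
split into a part keeping h_{m+1} and a part lowering it to h_m. The first parts assemble into the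
identity for the shorter word; the second parts cancel in pairs by the recursion for `triSign`. -/
theorem sum_freeD_freeE (n : ℕ) (x : FreeLambda 𝕜) :
    ∑ p ∈ antidiagonal (n + 1), triSign 𝕜 p.1 • freeD 𝕜 p.2 (freeE 𝕜 p.1 x) = 0 := by
  induction x using freeLambda_induction with
  | one =>
    refine Finset.sum_eq_zero fun p hp => ?_
    rw [HasAntidiagonal.mem_antidiagonal] at hp
    rw [freeE_one]
    split_ifs with h
    · rw [freeD_one, if_neg (by omega), smul_zero]
    · simp
  | mul m y hm ih =>
    obtain ⟨m, rfl⟩ := Nat.exists_eq_succ_of_ne_zero hm.ne'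
    have h1 : ∑ p ∈ antidiagonal (n + 1),
        triSign 𝕜 p.1 • freeD 𝕜 p.2 (freeE 𝕜 p.1 (freeH 𝕜 (m + 1) * y)) =
        ∑ p ∈ antidiagonal (n + 1), (triSign 𝕜 p.1 * (-1) ^ ((m + 1) * p.1)) •
          freeD 𝕜 p.2 (freeH 𝕜 (m + 1) * freeE 𝕜 p.1 y) +
        ∑ p ∈ antidiagonal n, (triSign 𝕜 (p.1 + 1) * (-1) ^ (m * p.1)) •
          freeD 𝕜 p.2 (freeH 𝕜 m * freeE 𝕜 p.1 y) := by
      rw [Finset.Nat.sum_antidiagonal_succ, Finset.Nat.sum_antidiagonal_succ, add_assoc,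
        ← Finset.sum_add_distrib]
      congr 1
      · simp [freeE_zero]
      · refine Finset.sum_congr rfl fun p _ => ?_
        rw [freeE_succ_freeH_succ_mul, map_add, map_smul, map_smul, smul_add, smul_smul, smul_smul]
    have h2 : ∑ p ∈ antidiagonal (n + 1), (triSign 𝕜 p.1 * (-1) ^ ((m + 1) * p.1)) •
          freeD 𝕜 p.2 (freeH 𝕜 (m + 1) * freeE 𝕜 p.1 y) =
        ∑ p ∈ antidiagonal (n + 1), (triSign 𝕜 p.1 * (-1) ^ ((m + 1) * p.1)) •
          ((-1 : 𝕜) ^ ((m + 1) * p.2) • (freeH 𝕜 (m + 1) * freeD 𝕜 p.2 (freeE 𝕜 p.1 y))) +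
        ∑ p ∈ antidiagonal n, (triSign 𝕜 p.1 * (-1) ^ ((m + 1) * p.1)) •
          freeD 𝕜 p.2 (freeH 𝕜 m * freeE 𝕜 p.1 y) := by
      rw [Finset.Nat.sum_antidiagonal_succ', Finset.Nat.sum_antidiagonal_succ', add_assoc,
        ← Finset.sum_add_distrib]
      congr 1
      · simp [freeD_zero]
      · refine Finset.sum_congr rfl fun p _ => ?_
        rw [freeD_succ_freeH_succ_mul, smul_add]
    have h3 : ∑ p ∈ antidiagonal (n + 1), (triSign 𝕜 p.1 * (-1) ^ ((m + 1) * p.1)) •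
          ((-1 : 𝕜) ^ ((m + 1) * p.2) • (freeH 𝕜 (m + 1) * freeD 𝕜 p.2 (freeE 𝕜 p.1 y))) =
        (-1 : 𝕜) ^ ((m + 1) * (n + 1)) • (freeH 𝕜 (m + 1) * ∑ p ∈ antidiagonal (n + 1),
          triSign 𝕜 p.1 • freeD 𝕜 p.2 (freeE 𝕜 p.1 y)) := by
      rw [Finset.mul_sum, Finset.smul_sum]
      refine Finset.sum_congr rfl fun p hp => ?_
      rw [HasAntidiagonal.mem_antidiagonal] at hp
      rw [← hp, mul_smul_comm, smul_smul, smul_smul, mul_assoc, ← pow_add, ← mul_add, mul_comm]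
    rw [h1, h2, h3, ih, mul_zero, smul_zero, zero_add, ← Finset.sum_add_distrib]
    refine Finset.sum_eq_zero fun p _ => ?_
    rw [← add_smul]
    have : triSign 𝕜 p.1 * (-1) ^ ((m + 1) * p.1) + triSign 𝕜 (p.1 + 1) * (-1) ^ (m * p.1) = 0 := by
      rw [triSign]
      ring
    rw [this, zero_smul]
  | add a b ha hb =>
    simp only [map_add, smul_add, Finset.sum_add_distrib, ha, hb, add_zero]
  | smul r a ha =>
    simp only [map_smul, smul_comm _ r, ← Finset.smul_sum, ha, smul_zero]

/-- Since `triSign` is a sign and `freeD 𝕜 0` is the identity, `sum_freeD_freeE` can be solved for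
the top `freeE` in terms of lower ones followed by `freeD`. -/
theorem freeE_mem_radical {x : FreeLambda 𝕜} (hx : x ∈ radical (-1 : 𝕜)) (c : ℕ) :
    freeE 𝕜 c x ∈ radical (-1 : 𝕜) := by
  induction c using Nat.strong_induction_on with
  | _ c ih =>
    rcases c with _ | n
    · rwa [freeE_zero]
    · have h := sum_freeD_freeE n x
      rw [Finset.Nat.sum_antidiagonal_succ', freeD_zero] at h
      have h2 : freeE 𝕜 (n + 1) x = triSign 𝕜 (n + 1) • triSign 𝕜 (n + 1) • freeE 𝕜 (n + 1) x := by
        rw [smul_smul, triSign_mul_self, one_smul]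
      rw [h2, eq_neg_of_add_eq_zero_left h]
      refine Submodule.smul_mem _ _ (Submodule.neg_mem _ (Submodule.sum_mem _ fun p hp => ?_))
      rw [HasAntidiagonal.mem_antidiagonal] at hp
      exact Submodule.smul_mem _ _ (freeD_mem_radical (ih _ (by omega)) _)

/-- An element lies in the radical if the counit and all `freeE c`, `0 < c`, send it there. -/
theorem mem_radical_of_freeE {x : FreeLambda 𝕜} (h0 : freeCounit 𝕜 x = 0)
    (h : ∀ c, 0 < c → freeE 𝕜 c x ∈ radical (-1 : 𝕜)) : x ∈ radical (-1 : 𝕜) := by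
  refine mem_radical_of_freeD h0 fun c hc => ?_
  obtain ⟨n, rfl⟩ := Nat.exists_eq_succ_of_ne_zero hc.ne'
  have h1 := sum_freeD_freeE n x
  rw [Finset.Nat.sum_antidiagonal_succ, freeE_zero, triSign, one_smul] at h1
  rw [Nat.succ_eq_add_one, eq_neg_of_add_eq_zero_left h1]
  exact Submodule.neg_mem _ (Submodule.sum_mem _ fun p _ =>
    Submodule.smul_mem _ _ (freeD_mem_radical (h _ p.1.succ_pos) _))

/-! ### Operators on the algebra of odd symmetric functions -/

theorem toOdd_surjective : Function.Surjective (toOdd 𝕜) := Ideal.Quotient.mkₐ_surjective _ _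

/-- The linear endomorphism of `Λ` induced by one of `Λ'` that preserves the radical. -/
def oddMap (f : FreeLambda 𝕜 →ₗ[𝕜] FreeLambda 𝕜)
    (hf : ∀ x ∈ radical (-1 : 𝕜), f x ∈ radical (-1 : 𝕜)) : OddLambda 𝕜 →ₗ[𝕜] OddLambda 𝕜 where
  toFun := Function.surjInv toOdd_surjective |> fun g x => toOdd 𝕜 (f (g x))
  map_add' x y := by
    rw [← map_add, ← map_add, ← sub_eq_zero, ← map_sub, ← map_sub, toOdd_eq_zero_iff]
    refine hf _ ((toOdd_eq_zero_iff _).1 ?_)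
    simp [Function.surjInv_eq]
  map_smul' a x := by
    rw [RingHom.id_apply, ← map_smul, ← map_smul, ← sub_eq_zero, ← map_sub, ← map_sub,
      toOdd_eq_zero_iff]
    refine hf _ ((toOdd_eq_zero_iff _).1 ?_)
    simp [Function.surjInv_eq]

theorem oddMap_toOdd (f : FreeLambda 𝕜 →ₗ[𝕜] FreeLambda 𝕜)
    (hf : ∀ x ∈ radical (-1 : 𝕜), f x ∈ radical (-1 : 𝕜)) (x : FreeLambda 𝕜) :
    oddMap f hf (toOdd 𝕜 x) = toOdd 𝕜 (f x) := by
  change toOdd 𝕜 (f _) = toOdd 𝕜 (f x)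
  rw [← sub_eq_zero, ← map_sub, ← map_sub, toOdd_eq_zero_iff]
  refine hf _ ((toOdd_eq_zero_iff _).1 ?_)
  simp [Function.surjInv_eq]

/-- The operators on `Λ` adjoint to left multiplication by `h_c`. -/
def oddD (𝕜 : Type*) [CommRing 𝕜] (c : ℕ) : OddLambda 𝕜 →ₗ[𝕜] OddLambda 𝕜 :=
  oddMap (freeD 𝕜 c) fun _ hx => freeD_mem_radical hx c

/-- The elementary operators on `Λ`. -/
def oddE (𝕜 : Type*) [CommRing 𝕜] (c : ℕ) : OddLambda 𝕜 →ₗ[𝕜] OddLambda 𝕜 :=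
  oddMap (freeE 𝕜 c) fun _ hx => freeE_mem_radical hx c

/-- The parity automorphism of `Λ`. -/
def oddSign (𝕜 : Type*) [CommRing 𝕜] : OddLambda 𝕜 →ₗ[𝕜] OddLambda 𝕜 :=
  oddMap (freeSign 𝕜).toLinearMap fun _ hx => freeSign_mem_radical hx

/-- The counit of `Λ`. -/
def oddCounit (𝕜 : Type*) [CommRing 𝕜] : OddLambda 𝕜 →ₐ[𝕜] 𝕜 :=
  Ideal.Quotient.liftₐ _ (freeCounit 𝕜) fun _ hx => freeCounit_of_mem_radical (radicalIdeal_le _ _ hx)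

theorem oddD_toOdd (c : ℕ) (x : FreeLambda 𝕜) : oddD 𝕜 c (toOdd 𝕜 x) = toOdd 𝕜 (freeD 𝕜 c x) :=
  oddMap_toOdd _ _ _

theorem oddE_toOdd (c : ℕ) (x : FreeLambda 𝕜) : oddE 𝕜 c (toOdd 𝕜 x) = toOdd 𝕜 (freeE 𝕜 c x) :=
  oddMap_toOdd _ _ _

theorem oddSign_toOdd (x : FreeLambda 𝕜) : oddSign 𝕜 (toOdd 𝕜 x) = toOdd 𝕜 (freeSign 𝕜 x) :=
  oddMap_toOdd _ _ _

theorem oddCounit_toOdd (x : FreeLambda 𝕜) : oddCounit 𝕜 (toOdd 𝕜 x) = freeCounit 𝕜 x := rfl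

theorem oddSign_pow_toOdd (j : ℕ) (x : FreeLambda 𝕜) :
    (oddSign 𝕜 ^ j) (toOdd 𝕜 x) = toOdd 𝕜 ((freeSign 𝕜 ^ j) x) := by
  induction j with
  | zero => simp
  | succ j ih => rw [pow_succ', Module.End.mul_apply, ih, oddSign_toOdd, pow_succ', AlgHom.mul_apply]

theorem toOdd_freeH (n : ℕ) : toOdd 𝕜 (freeH 𝕜 n) = oddH 𝕜 n := by
  rw [freeH, oddH]
  split_ifs <;> simp

theorem oddH_zero : oddH 𝕜 0 = 1 := by simp [oddH]

theorem oddSign_mul (x y : OddLambda 𝕜) : oddSign 𝕜 (x * y) = oddSign 𝕜 x * oddSign 𝕜 y := by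
  obtain ⟨x, rfl⟩ := toOdd_surjective x
  obtain ⟨y, rfl⟩ := toOdd_surjective y
  simp only [← map_mul, oddSign_toOdd]

theorem oddSign_one : oddSign 𝕜 1 = 1 := by
  rw [← map_one (toOdd 𝕜), oddSign_toOdd, map_one]

theorem oddD_mul (c : ℕ) (x y : OddLambda 𝕜) :
    oddD 𝕜 c (x * y) =
      ∑ p ∈ antidiagonal c, (oddSign 𝕜 ^ p.2) (oddD 𝕜 p.1 x) * oddD 𝕜 p.2 y := by
  obtain ⟨x, rfl⟩ := toOdd_surjective x
  obtain ⟨y, rfl⟩ := toOdd_surjective y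
  simp only [← map_mul, oddD_toOdd, freeD_mul, map_sum, oddSign_pow_toOdd]

theorem oddE_mul (c : ℕ) (x y : OddLambda 𝕜) :
    oddE 𝕜 c (x * y) =
      ∑ p ∈ antidiagonal c, (oddSign 𝕜 ^ p.2) (oddE 𝕜 p.1 x) * oddE 𝕜 p.2 y := by
  obtain ⟨x, rfl⟩ := toOdd_surjective x
  obtain ⟨y, rfl⟩ := toOdd_surjective y
  simp only [← map_mul, oddE_toOdd, freeE_mul, map_sum, oddSign_pow_toOdd]

theorem oddD_zero (x : OddLambda 𝕜) : oddD 𝕜 0 x = x := by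
  obtain ⟨x, rfl⟩ := toOdd_surjective x
  rw [oddD_toOdd, freeD_zero]

theorem oddE_zero (x : OddLambda 𝕜) : oddE 𝕜 0 x = x := by
  obtain ⟨x, rfl⟩ := toOdd_surjective x
  rw [oddE_toOdd, freeE_zero]

theorem oddE_one (c : ℕ) : oddE 𝕜 c 1 = if c = 0 then 1 else 0 := by
  rw [← map_one (toOdd 𝕜), oddE_toOdd, freeE_one]
  split_ifs <;> simp

theorem oddD_oddH (m c : ℕ) : oddD 𝕜 c (oddH 𝕜 m) = if c ≤ m then oddH 𝕜 (m - c) else 0 := by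
  rw [← toOdd_freeH, oddD_toOdd, freeD_freeH]
  split_ifs <;> simp [toOdd_freeH]

theorem oddE_oddH (m c : ℕ) :
    oddE 𝕜 c (oddH 𝕜 m) = if c ≤ 1 ∧ c ≤ m then oddH 𝕜 (m - c) else 0 := by
  rw [← toOdd_freeH, oddE_toOdd, freeE_freeH]
  split_ifs <;> simp [toOdd_freeH]

theorem oddSign_oddH (m : ℕ) : oddSign 𝕜 (oddH 𝕜 m) = (-1 : 𝕜) ^ m • oddH 𝕜 m := by
  rw [← toOdd_freeH, oddSign_toOdd, freeSign_freeH, map_smul]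

theorem oddCounit_oddH (n : ℕ) : oddCounit 𝕜 (oddH 𝕜 n) = if n = 0 then 1 else 0 := by
  rw [← toOdd_freeH, oddCounit_toOdd, freeCounit_freeH]

theorem eq_zero_of_oddD {x : OddLambda 𝕜} (h0 : oddCounit 𝕜 x = 0)
    (h : ∀ c, 0 < c → oddD 𝕜 c x = 0) : x = 0 := by
  obtain ⟨x, rfl⟩ := toOdd_surjective x
  rw [toOdd_eq_zero_iff]
  refine mem_radical_of_freeD h0 fun c hc => ?_
  rw [← toOdd_eq_zero_iff, ← oddD_toOdd, h c hc]

theorem eq_zero_of_oddE {x : OddLambda 𝕜} (h0 : oddCounit 𝕜 x = 0)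
    (h : ∀ c, 0 < c → oddE 𝕜 c x = 0) : x = 0 := by
  obtain ⟨x, rfl⟩ := toOdd_surjective x
  rw [toOdd_eq_zero_iff]
  refine mem_radical_of_freeE h0 fun c hc => ?_
  rw [← toOdd_eq_zero_iff, ← oddE_toOdd, h c hc]

/-! ### The defining relations -/

/-- `h_n` for an integer `n`, zero for `n < 0`. -/
def oddHZ (𝕜 : Type*) [CommRing 𝕜] (n : ℤ) : OddLambda 𝕜 := if n < 0 then 0 else oddH 𝕜 n.toNat

theorem oddHZ_of_neg {n : ℤ} (hn : n < 0) : oddHZ 𝕜 n = 0 := if_pos hn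

theorem oddHZ_natCast (n : ℕ) : oddHZ 𝕜 n = oddH 𝕜 n := by simp [oddHZ]

/-- Extending h_n by zero to negative n removes the boundary case at n = 0, so the relations can be
shifted freely. -/
theorem oddE_one_oddHZ (n : ℤ) : oddE 𝕜 1 (oddHZ 𝕜 n) = oddHZ 𝕜 (n - 1) := by
  rcases lt_or_ge n 0 with hn | hn
  · rw [oddHZ_of_neg hn, oddHZ_of_neg (by omega), map_zero]
  · lift n to ℕ using hn
    rw [oddHZ_natCast, oddE_oddH]
    rcases n with _ | n
    · rw [if_neg (by simp), oddHZ_of_neg (by simp)]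
    · rw [if_pos (by simp)]
      simp [oddHZ]

theorem oddE_oddHZ {c : ℕ} (hc : 2 ≤ c) (n : ℤ) : oddE 𝕜 c (oddHZ 𝕜 n) = 0 := by
  rw [oddHZ]
  split_ifs
  · simp
  · rw [oddE_oddH, if_neg (by omega)]

theorem oddSign_oddHZ_even {n : ℤ} (hn : Even n) : oddSign 𝕜 (oddHZ 𝕜 n) = oddHZ 𝕜 n := by
  rcases lt_or_ge n 0 with h | h
  · rw [oddHZ_of_neg h, map_zero]
  · lift n to ℕ using h
    rw [oddHZ_natCast, oddSign_oddH, Even.neg_one_pow (by exact_mod_cast hn), one_smul]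

theorem oddSign_oddHZ_odd {n : ℤ} (hn : Odd n) : oddSign 𝕜 (oddHZ 𝕜 n) = -oddHZ 𝕜 n := by
  rcases lt_or_ge n 0 with h | h
  · rw [oddHZ_of_neg h, map_zero, neg_zero]
  · lift n to ℕ using h
    rw [oddHZ_natCast, oddSign_oddH, Odd.neg_one_pow (by exact_mod_cast hn), neg_smul, one_smul]

theorem oddE_one_mul (a b : ℤ) : oddE 𝕜 1 (oddHZ 𝕜 a * oddHZ 𝕜 b) =
    oddSign 𝕜 (oddHZ 𝕜 a) * oddHZ 𝕜 (b - 1) + oddHZ 𝕜 (a - 1) * oddHZ 𝕜 b := by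
  rw [oddE_mul, Finset.Nat.sum_antidiagonal_succ]
  simp [oddE_zero, oddE_one_oddHZ]

theorem oddE_two_mul (a b : ℤ) : oddE 𝕜 2 (oddHZ 𝕜 a * oddHZ 𝕜 b) =
    oddSign 𝕜 (oddHZ 𝕜 (a - 1)) * oddHZ 𝕜 (b - 1) := by
  rw [oddE_mul, Finset.Nat.sum_antidiagonal_succ, Finset.Nat.sum_antidiagonal_succ]
  simp [oddE_zero, oddE_one_oddHZ, oddE_oddHZ]

theorem oddE_mul_eq_zero {c : ℕ} (hc : 3 ≤ c) (a b : ℤ) :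
    oddE 𝕜 c (oddHZ 𝕜 a * oddHZ 𝕜 b) = 0 := by
  rw [oddE_mul]
  refine Finset.sum_eq_zero fun p hp => ?_
  rw [HasAntidiagonal.mem_antidiagonal] at hp
  rcases le_or_gt 2 p.1 with h | h
  · rw [oddE_oddHZ h, map_zero, zero_mul]
  · rw [oddE_oddHZ (c := p.2) (by omega), mul_zero]

theorem oddCounit_oddHZ_mul {a b : ℤ} (h : a + b ≠ 0) :
    oddCounit 𝕜 (oddHZ 𝕜 a * oddHZ 𝕜 b) = 0 := by
  rw [map_mul]
  have h1 : ∀ n : ℤ, n ≠ 0 → oddCounit 𝕜 (oddHZ 𝕜 n) = 0 := by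
    intro n hn
    rw [oddHZ]
    split_ifs with h
    · simp
    · rw [oddCounit_oddH, if_neg (by omega)]
  by_cases ha : a = 0
  · rw [h1 b (by omega), mul_zero]
  · rw [h1 a ha, zero_mul]

theorem eq_zero_of_oddE_one_two {x : OddLambda 𝕜} (h0 : oddCounit 𝕜 x = 0)
    (h1 : oddE 𝕜 1 x = 0) (h2 : oddE 𝕜 2 x = 0) (h3 : ∀ c, 3 ≤ c → oddE 𝕜 c x = 0) : x = 0 := by
  refine eq_zero_of_oddE h0 fun c hc => ?_
  rcases c with _ | _ | _ | c
  · omega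
  · exact h1
  · exact h2
  · exact h3 _ (by omega)

theorem oddHZ_mul_of_neg {a b : ℤ} (h : a + b < 0) : oddHZ 𝕜 a * oddHZ 𝕜 b = 0 := by
  rcases lt_or_ge a 0 with ha | ha
  · rw [oddHZ_of_neg ha, zero_mul]
  · rw [oddHZ_of_neg (n := b) (by omega), mul_zero]

/-- The three families are proved together, because E_1 and E_2 send each relation to combinations
of relations of total degree one and two lower, while E_c kills it for c ≥ 3. E_1 exchanges the
commutation relations with the two mixed families; E_2 exchanges the two mixed families with each
other. -/
theorem oddHZ_relations (a b : ℤ) :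
    (Even (a + b) → oddHZ 𝕜 a * oddHZ 𝕜 b - oddHZ 𝕜 b * oddHZ 𝕜 a = 0) ∧
    (Even a → Odd b → oddHZ 𝕜 a * oddHZ 𝕜 b + oddHZ 𝕜 b * oddHZ 𝕜 a -
      (oddHZ 𝕜 (a + 1) * oddHZ 𝕜 (b - 1) + oddHZ 𝕜 (b - 1) * oddHZ 𝕜 (a + 1)) = 0) ∧
    (Odd a → Even b → oddHZ 𝕜 a * oddHZ 𝕜 b - oddHZ 𝕜 b * oddHZ 𝕜 a +
      (oddHZ 𝕜 (a + 1) * oddHZ 𝕜 (b - 1) - oddHZ 𝕜 (b - 1) * oddHZ 𝕜 (a + 1)) = 0) := by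
  -- Induction on an upper bound for the degree; in negative degree all the products vanish.
  suffices key : ∀ n : ℕ, ∀ a b : ℤ, a + b < n →
      (Even (a + b) → oddHZ 𝕜 a * oddHZ 𝕜 b - oddHZ 𝕜 b * oddHZ 𝕜 a = 0) ∧
      (Even a → Odd b → oddHZ 𝕜 a * oddHZ 𝕜 b + oddHZ 𝕜 b * oddHZ 𝕜 a -
        (oddHZ 𝕜 (a + 1) * oddHZ 𝕜 (b - 1) + oddHZ 𝕜 (b - 1) * oddHZ 𝕜 (a + 1)) = 0) ∧
      (Odd a → Even b → oddHZ 𝕜 a * oddHZ 𝕜 b - oddHZ 𝕜 b * oddHZ 𝕜 a +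
        (oddHZ 𝕜 (a + 1) * oddHZ 𝕜 (b - 1) - oddHZ 𝕜 (b - 1) * oddHZ 𝕜 (a + 1)) = 0) from
    key ((a + b).toNat + 1) a b (by push_cast; omega)
  intro n
  induction n with
  | zero =>
    intro a b hab
    have h1 : oddHZ 𝕜 a * oddHZ 𝕜 b = 0 := oddHZ_mul_of_neg (by simpa using hab)
    have h2 : oddHZ 𝕜 b * oddHZ 𝕜 a = 0 := oddHZ_mul_of_neg (by push_cast at hab; omega)
    have h3 : oddHZ 𝕜 (a + 1) * oddHZ 𝕜 (b - 1) = 0 :=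
      oddHZ_mul_of_neg (by push_cast at hab; omega)
    have h4 : oddHZ 𝕜 (b - 1) * oddHZ 𝕜 (a + 1) = 0 :=
      oddHZ_mul_of_neg (by push_cast at hab; omega)
    simp [h1, h2, h3, h4]
  | succ n ih =>
    intro a b hab
    push_cast at hab
    have hc1 : ∀ c, 3 ≤ c → ∀ a b : ℤ, oddE 𝕜 c (oddHZ 𝕜 a * oddHZ 𝕜 b) = 0 :=
      fun c hc a b => oddE_mul_eq_zero hc a b
    refine ⟨fun hE => ?_, fun ha hb => ?_, fun ha hb => ?_⟩
    · have i1 := ih (a - 1) b (by omega)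
      have i2 := ih (a - 1) (b - 1) (by omega)
      have i3 := i2.1 (by
        have := hE.sub even_two
        rwa [show a + b - 2 = a - 1 + (b - 1) by ring] at this)
      refine eq_zero_of_oddE_one_two ?_ ?_ ?_ ?_
      · rw [map_sub, map_mul, map_mul, mul_comm, sub_self]
      · rw [map_sub, oddE_one_mul, oddE_one_mul]
        rcases Int.even_or_odd a with ha | ha
        · have hb : Even b := by rwa [Int.even_add, iff_true_left ha] at hE
          have j := i1.2.2 (ha.sub_odd odd_one) hb
          rw [sub_add_cancel] at j
          rw [oddSign_oddHZ_even ha, oddSign_oddHZ_even hb, ← j]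
          abel
        · have hb : Odd b := by
            rw [← Int.not_even_iff_odd] at ha ⊢
            rwa [Int.even_add, iff_false_left ha] at hE
          have j := i1.2.1 (ha.sub_odd odd_one) hb
          rw [sub_add_cancel] at j
          rw [oddSign_oddHZ_odd ha, oddSign_oddHZ_odd hb, ← j]
          simp only [neg_mul]
          abel
      · rw [map_sub, oddE_two_mul, oddE_two_mul]
        rcases Int.even_or_odd a with ha | ha
        · have hb : Even b := by rwa [Int.even_add, iff_true_left ha] at hE
          rw [oddSign_oddHZ_odd (ha.sub_odd odd_one), oddSign_oddHZ_odd (hb.sub_odd odd_one),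
            neg_mul, neg_mul, ← neg_eq_zero, ← i3]
          abel
        · have hb : Odd b := by
            rw [← Int.not_even_iff_odd] at ha ⊢
            rwa [Int.even_add, iff_false_left ha] at hE
          rw [oddSign_oddHZ_even (ha.sub_odd odd_one), oddSign_oddHZ_even (hb.sub_odd odd_one), i3]
      · intro c hc
        rw [map_sub, hc1 c hc, hc1 c hc, sub_zero]
    · have hodd : a + b ≠ 0 := by
        intro h
        have := ha.add_odd hb
        rw [h] at this
        exact absurd this (by decide)
      have i1 := (ih (a - 1) b (by omega)).1 ((ha.sub_odd odd_one).add_odd hb)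
      have i2 := (ih (a + 1) (b - 2) (by omega)).1
        ((ha.add_odd odd_one).add_odd (hb.sub_even even_two))
      have i3 := (ih (a - 1) (b - 1) (by omega)).2.2 (ha.sub_odd odd_one) (hb.sub_odd odd_one)
      have e1 : b - 1 - 1 = b - 2 := by ring
      rw [sub_add_cancel, e1] at i3
      refine eq_zero_of_oddE_one_two ?_ ?_ ?_ ?_
      · rw [map_sub, map_add, map_add, oddCounit_oddHZ_mul hodd,
          oddCounit_oddHZ_mul (by omega), oddCounit_oddHZ_mul (by omega),
          oddCounit_oddHZ_mul (by omega)]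
        simp
      · rw [map_sub, map_add, map_add, oddE_one_mul, oddE_one_mul, oddE_one_mul, oddE_one_mul,
          oddSign_oddHZ_even ha, oddSign_oddHZ_odd hb, oddSign_oddHZ_odd (ha.add_odd odd_one),
          oddSign_oddHZ_even (hb.sub_odd odd_one), add_sub_cancel_right, e1]
        have i4 := congrArg₂ (· + ·) i1 i2
        simp only [add_zero] at i4
        rw [← i4]
        simp only [neg_mul]
        abel
      · rw [map_sub, map_add, map_add, oddE_two_mul, oddE_two_mul, oddE_two_mul, oddE_two_mul,
          add_sub_cancel_right, e1, oddSign_oddHZ_odd (ha.sub_odd odd_one),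
          oddSign_oddHZ_even (hb.sub_odd odd_one), oddSign_oddHZ_even ha,
          oddSign_oddHZ_odd (hb.sub_even even_two), ← neg_eq_zero, ← i3]
        simp only [neg_mul]
        abel
      · intro c hc
        rw [map_sub, map_add, map_add, hc1 c hc, hc1 c hc, hc1 c hc, hc1 c hc]
        simp
    · have i1 := (ih (a - 1) b (by omega)).1 ((ha.sub_odd odd_one).add hb)
      have i2 := (ih (a + 1) (b - 2) (by omega)).1
        ((ha.add_odd odd_one).add (hb.sub even_two))
      have i3 := (ih (a - 1) (b - 1) (by omega)).2.1 (ha.sub_odd odd_one) (hb.sub_odd odd_one)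
      have e1 : b - 1 - 1 = b - 2 := by ring
      rw [sub_add_cancel, e1] at i3
      refine eq_zero_of_oddE_one_two ?_ ?_ ?_ ?_
      · simp only [map_add, map_sub, map_mul]
        ring
      · rw [map_add, map_sub, map_sub, oddE_one_mul, oddE_one_mul, oddE_one_mul, oddE_one_mul,
          oddSign_oddHZ_odd ha, oddSign_oddHZ_even hb, oddSign_oddHZ_even (ha.add_odd odd_one),
          oddSign_oddHZ_odd (hb.sub_odd odd_one), add_sub_cancel_right, e1]
        have i4 := congrArg₂ (· + ·) i1 i2
        simp only [add_zero] at i4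
        rw [← i4]
        simp only [neg_mul]
        abel
      · rw [map_add, map_sub, map_sub, oddE_two_mul, oddE_two_mul, oddE_two_mul, oddE_two_mul,
          add_sub_cancel_right, e1, oddSign_oddHZ_even (ha.sub_odd odd_one),
          oddSign_oddHZ_odd (hb.sub_odd odd_one), oddSign_oddHZ_odd ha,
          oddSign_oddHZ_even (hb.sub even_two), ← i3]
        simp only [neg_mul]
        abel
      · intro c hc
        rw [map_add, map_sub, map_sub, hc1 c hc, hc1 c hc, hc1 c hc, hc1 c hc]
        simp


/-! ### Spanning by partitions -/

theorem oddH_mul_comm_of_even {a b : ℕ} (h : Even (a + b)) :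
    oddH 𝕜 a * oddH 𝕜 b = oddH 𝕜 b * oddH 𝕜 a := by
  have := (oddHZ_relations (𝕜 := 𝕜) a b).1 (by exact_mod_cast h)
  simpa only [oddHZ_natCast, sub_eq_zero] using this

/-- Straightening: when a < b the leading letter strictly increases. In even total degree the
letters commute; in odd degree the mixed relation for (a - 1, b + 1) trades h_a h_b for products led
by b or b + 1 and for h_{a-1} h_{b+1}, to which induction on a applies. -/
theorem oddH_mul_mem_span (a b : ℕ) : oddH 𝕜 a * oddH 𝕜 b ∈
    Submodule.span 𝕜 {x | ∃ c d, c + d = a + b ∧ b ≤ c ∧ oddH 𝕜 c * oddH 𝕜 d = x} := by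
  induction a generalizing b with
  | zero => exact Submodule.subset_span ⟨b, 0, by simp, le_rfl, by simp [oddH_zero]⟩
  | succ a ih =>
    by_cases hE : Even (a + 1 + b)
    · exact Submodule.subset_span ⟨b, a + 1, by omega, le_rfl, (oddH_mul_comm_of_even hE).symm⟩
    have h1 : oddH 𝕜 b * oddH 𝕜 (a + 1) ∈ Submodule.span 𝕜
        {x | ∃ c d, c + d = a + 1 + b ∧ b ≤ c ∧ oddH 𝕜 c * oddH 𝕜 d = x} :=
      Submodule.subset_span ⟨b, a + 1, by omega, le_rfl, rfl⟩
    have h2 : oddH 𝕜 (b + 1) * oddH 𝕜 a ∈ Submodule.span 𝕜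
        {x | ∃ c d, c + d = a + 1 + b ∧ b ≤ c ∧ oddH 𝕜 c * oddH 𝕜 d = x} :=
      Submodule.subset_span ⟨b + 1, a, by omega, by omega, rfl⟩
    have h3 : oddH 𝕜 a * oddH 𝕜 (b + 1) ∈ Submodule.span 𝕜
        {x | ∃ c d, c + d = a + 1 + b ∧ b ≤ c ∧ oddH 𝕜 c * oddH 𝕜 d = x} := by
      refine Submodule.span_mono ?_ (ih (b + 1))
      rintro x ⟨c, d, h, h', rfl⟩
      exact ⟨c, d, by omega, by omega, rfl⟩
    have hc : ((a : ℤ) + 1 = ((a + 1 : ℕ) : ℤ)) ∧ ((b : ℤ) + 1 = ((b + 1 : ℕ) : ℤ)) := by simp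
    rcases Nat.even_or_odd a with ha | ha
    · have hb : Even b := by
        by_contra hb
        exact hE (ha.add_one.add_odd (Nat.not_even_iff_odd.1 hb))
      have := (oddHZ_relations (𝕜 := 𝕜) a (b + 1)).2.1 (by exact_mod_cast ha)
        (by exact_mod_cast hb.add_one)
      rw [add_sub_cancel_right, hc.1, hc.2] at this
      simp only [oddHZ_natCast] at this
      have e : oddH 𝕜 (a + 1) * oddH 𝕜 b =
          oddH 𝕜 a * oddH 𝕜 (b + 1) + oddH 𝕜 (b + 1) * oddH 𝕜 a - oddH 𝕜 b * oddH 𝕜 (a + 1) := by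
        rw [eq_sub_iff_add_eq, ← sub_eq_zero, ← neg_sub, this, neg_zero]
      rw [e]
      exact Submodule.sub_mem _ (Submodule.add_mem _ h3 h2) h1
    · have hb : Odd b := by
        by_contra hb
        exact hE (ha.add_one.add (Nat.not_odd_iff_even.1 hb))
      have := (oddHZ_relations (𝕜 := 𝕜) a (b + 1)).2.2 (by exact_mod_cast ha)
        (by exact_mod_cast hb.add_one)
      rw [add_sub_cancel_right, hc.1, hc.2] at this
      simp only [oddHZ_natCast] at this
      have e : oddH 𝕜 (a + 1) * oddH 𝕜 b =
          oddH 𝕜 b * oddH 𝕜 (a + 1) - (oddH 𝕜 a * oddH 𝕜 (b + 1) - oddH 𝕜 (b + 1) * oddH 𝕜 a) := by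
        rw [← sub_eq_zero, ← this]
        abel
      rw [e]
      exact Submodule.sub_mem _ h1 (Submodule.sub_mem _ h3 h2)

/-- The product `h_{a_1} ⋯ h_{a_r}` in `Λ` for a list of natural numbers. -/
def oddHList (𝕜 : Type*) [CommRing 𝕜] (l : List ℕ) : OddLambda 𝕜 := (l.map (oddH 𝕜)).prod

@[simp] theorem oddHList_nil : oddHList 𝕜 [] = 1 := rfl

@[simp] theorem oddHList_cons (a : ℕ) (l : List ℕ) :
    oddHList 𝕜 (a :: l) = oddH 𝕜 a * oddHList 𝕜 l := by simp [oddHList]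

theorem toOdd_basis (w : FreeMonoid ℕ+) :
    toOdd 𝕜 (FreeAlgebra.basisFreeMonoid 𝕜 ℕ+ w) = oddHList 𝕜 (letters w) := by
  rw [basis_eq_prod, map_list_prod, List.map_map, oddHList]
  congr 2
  funext m
  exact toOdd_freeH m

theorem exists_word_oddHList (l : List ℕ) : ∃ w : FreeMonoid ℕ+, wordDegree w = l.sum ∧
    toOdd 𝕜 (FreeAlgebra.basisFreeMonoid 𝕜 ℕ+ w) = oddHList 𝕜 l := by
  induction l with
  | nil => exact ⟨1, rfl, by rw [toOdd_basis]; rfl⟩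
  | cons a l ih =>
    obtain ⟨w, h1, h2⟩ := ih
    rcases Nat.eq_zero_or_pos a with rfl | ha
    · exact ⟨w, by simpa using h1, by simp [oddH_zero, h2]⟩
    · lift a to ℕ+ using ha
      refine ⟨FreeMonoid.of a * w, ?_, ?_⟩
      · rw [List.sum_cons, ← h1]
        rfl
      · rw [oddHList_cons, ← h2, toOdd_basis, toOdd_basis, ← oddHList_cons]
        rfl

theorem oddHList_mem_oddDegree (l : List ℕ) : oddHList 𝕜 l ∈ oddDegree 𝕜 l.sum :=
  Submodule.subset_span (exists_word_oddHList l)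

theorem oddDegree_eq_span (n : ℕ) :
    oddDegree 𝕜 n = Submodule.span 𝕜 {x | ∃ l : List ℕ, l.sum = n ∧ oddHList 𝕜 l = x} := by
  apply le_antisymm
  · refine Submodule.span_mono ?_
    rintro x ⟨w, h, rfl⟩
    exact ⟨letters w, h, (toOdd_basis w).symm⟩
  · rw [Submodule.span_le]
    rintro x ⟨l, rfl, rfl⟩
    exact oddHList_mem_oddDegree l

theorem oddH_mul_mem_oddDegree {a m n : ℕ} (h : a + m = n) {y : OddLambda 𝕜}
    (hy : y ∈ oddDegree 𝕜 m) : oddH 𝕜 a * y ∈ oddDegree 𝕜 n := by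
  rw [oddDegree_eq_span m] at hy
  suffices Submodule.span 𝕜 {x | ∃ l : List ℕ, l.sum = m ∧ oddHList 𝕜 l = x} ≤
      (oddDegree 𝕜 n).comap (LinearMap.mulLeft 𝕜 (oddH 𝕜 a)) from this hy
  rw [Submodule.span_le]
  rintro x ⟨l, rfl, rfl⟩
  have := oddHList_mem_oddDegree (𝕜 := 𝕜) (a :: l)
  rw [List.sum_cons, h, oddHList_cons] at this
  exact this

/-- A list of parts of a partition of `n`, in decreasing order. -/
def IsPartList (n : ℕ) (l : List ℕ) : Prop :=
  l.Pairwise (· ≥ ·) ∧ (∀ a ∈ l, 0 < a) ∧ l.sum = n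

/-- The span of the `h_λ` for the partitions `λ` of `n` with at least `r` parts. -/
def partSpan (𝕜 : Type*) [CommRing 𝕜] (n r : ℕ) : Submodule 𝕜 (OddLambda 𝕜) :=
  Submodule.span 𝕜 {x | ∃ l, IsPartList n l ∧ r ≤ l.length ∧ oddHList 𝕜 l = x}

/-- Straightens the first two letters of a word. The bound c ≤ a + b matters later: if letters
remain in `l`, the new leading letter cannot exhaust the degree. -/
theorem oddH_mul_oddHList_mem {T : Submodule 𝕜 (OddLambda 𝕜)} {n a b : ℕ} {l : List ℕ}
    (hsum : a + (b + l.sum) = n)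
    (h : ∀ c, b ≤ c → c ≤ a + b → ∀ y ∈ oddDegree 𝕜 (n - c), oddH 𝕜 c * y ∈ T) :
    oddH 𝕜 a * oddHList 𝕜 (b :: l) ∈ T := by
  rw [oddHList_cons, ← mul_assoc]
  suffices Submodule.span 𝕜 {x | ∃ c d, c + d = a + b ∧ b ≤ c ∧ oddH 𝕜 c * oddH 𝕜 d = x} ≤
      T.comap (LinearMap.mulRight 𝕜 (oddHList 𝕜 l)) from this (oddH_mul_mem_span a b)
  rw [Submodule.span_le]
  rintro x ⟨c, d, h1, h2, rfl⟩
  change oddH 𝕜 c * oddH 𝕜 d * oddHList 𝕜 l ∈ T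
  rw [mul_assoc]
  exact h c h2 (by omega) _ (oddH_mul_mem_oddDegree (by omega) (oddHList_mem_oddDegree l))

theorem isPartList_cons {a b m n : ℕ} {l : List ℕ} (hl : IsPartList m (b :: l)) (hba : b ≤ a)
    (ha : 0 < a) (h : a + m = n) : IsPartList n (a :: b :: l) := by
  obtain ⟨h1, h2, h3⟩ := hl
  refine ⟨List.pairwise_cons.2 ⟨fun c hc => ?_, h1⟩, ?_, by rw [List.sum_cons, h3, h]⟩
  · rcases List.mem_cons.1 hc with rfl | hc
    · exact hba
    · exact ((List.pairwise_cons.1 h1).1 c hc).trans hba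
  · intro c hc
    rcases List.mem_cons.1 hc with rfl | hc
    · exact ha
    · exact h2 c hc

theorem oddDegree_le_partSpan (n : ℕ) : oddDegree 𝕜 n ≤ partSpan 𝕜 n 0 := by
  induction n using Nat.strong_induction_on with
  | _ n ih =>
    -- The tail is straightened by induction on degree. If its first part still exceeds `a`,
    -- straightening makes the leading letter larger, which decreases `n - a`.
    have key : ∀ k a, n - a = k → 0 < a → a ≤ n → ∀ y ∈ oddDegree 𝕜 (n - a),
        oddH 𝕜 a * y ∈ partSpan 𝕜 n 0 := by
      intro k
      induction k using Nat.strong_induction_on with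
      | _ k ihk =>
        rintro a rfl ha han y hy
        have hy := ih (n - a) (by omega) hy
        suffices partSpan 𝕜 (n - a) 0 ≤
          (partSpan 𝕜 n 0).comap (LinearMap.mulLeft 𝕜 (oddH 𝕜 a)) from this hy
        rw [partSpan, Submodule.span_le]
        rintro _ ⟨l, hl, -, rfl⟩
        change oddH 𝕜 a * oddHList 𝕜 l ∈ partSpan 𝕜 n 0
        rcases l with _ | ⟨b, l⟩
        · have : n - a = 0 := hl.2.2.symm
          refine Submodule.subset_span ⟨[a], ⟨by simp, by simpa using ha, ?_⟩, by simp, by simp⟩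
          rw [List.sum_singleton]
          omega
        · by_cases hba : b ≤ a
          · exact Submodule.subset_span
              ⟨a :: b :: l, isPartList_cons hl hba ha (by omega), by simp, by simp⟩
          · have hs := hl.2.2
            rw [List.sum_cons] at hs
            refine oddH_mul_oddHList_mem (n := n) (by omega) fun c h1 h2 z hz => ?_
            exact ihk (n - c) (by omega) c rfl (by omega) (by omega) z hz
    conv_lhs => rw [oddDegree_eq_span]
    rw [Submodule.span_le]
    rintro _ ⟨l, hl, rfl⟩
    induction l with
    | nil =>
      exact Submodule.subset_span ⟨[], ⟨by simp, by simp, hl⟩, by simp, rfl⟩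
    | cons a l ihl =>
      rw [List.sum_cons] at hl
      rcases Nat.eq_zero_or_pos a with rfl | ha
      · rw [oddHList_cons, oddH_zero, one_mul]
        exact ihl (by omega)
      · rw [oddHList_cons]
        refine key _ a rfl ha (by omega) _ ?_
        rw [show n - a = l.sum by omega]
        exact oddHList_mem_oddDegree l

/-- This is where parity enters. It fails for odd degrees: h_2 h_1 + h_1 h_2 = 2 h_3. -/
theorem oddH_mul_mem_partSpan_two {n : ℕ} (hn : Even n) {a : ℕ} (ha : 0 < a) (han : a < n)
    {y : OddLambda 𝕜} (hy : y ∈ oddDegree 𝕜 (n - a)) : oddH 𝕜 a * y ∈ partSpan 𝕜 n 2 := by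
  induction hk : n - a using Nat.strong_induction_on generalizing a y with
  | _ k ihk =>
    subst hk
    have hy := oddDegree_le_partSpan _ hy
    suffices partSpan 𝕜 (n - a) 0 ≤
      (partSpan 𝕜 n 2).comap (LinearMap.mulLeft 𝕜 (oddH 𝕜 a)) from this hy
    rw [partSpan, Submodule.span_le]
    rintro _ ⟨l, hl, -, rfl⟩
    change oddH 𝕜 a * oddHList 𝕜 l ∈ partSpan 𝕜 n 2
    rcases l with _ | ⟨b, l⟩
    · have : n - a = 0 := hl.2.2.symm
      omega
    · have hs := hl.2.2
      rw [List.sum_cons] at hs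
      by_cases hba : b ≤ a
      · exact Submodule.subset_span
          ⟨a :: b :: l, isPartList_cons hl hba ha (by omega), by simp, by simp⟩
      -- Two letters have even total degree and commute, so h_n does not appear. With a further
      -- letter `d > 0`, every new leading letter is at most `a + b < n`.
      · rcases l with _ | ⟨d, l⟩
        · rw [List.sum_nil] at hs
          refine Submodule.subset_span ⟨[b, a], ⟨by simp; omega, by simp; omega, by simp; omega⟩,
            by simp, ?_⟩
          have : Even (b + a) := by rwa [show b + a = n by omega]
          simp [oddH_mul_comm_of_even this]
        · have hd : 0 < d := hl.2.1 d (by simp)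
          rw [List.sum_cons] at hs
          refine oddH_mul_oddHList_mem (n := n) (by rw [List.sum_cons]; omega)
            fun c h1 h2 z hz => ?_
          exact ihk (n - c) (by omega) (by omega) (by omega) hz rfl

/-! ### Linear independence -/

/-- Each letter can lose at most one unit, so removing r units needs at least r letters, and with
exactly r letters every one is lowered. -/
theorem oddE_oddHList (r : ℕ) (l : List ℕ) (hl : l.length ≤ r) (hpos : ∀ a ∈ l, 0 < a) :
    ∃ s : 𝕜, IsUnit s ∧ oddE 𝕜 r (oddHList 𝕜 l) =
      if l.length = r then s • oddHList 𝕜 (l.map Nat.pred) else 0 := by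
  induction l generalizing r with
  | nil =>
    refine ⟨1, isUnit_one, ?_⟩
    rw [oddHList_nil, oddE_one]
    simp [eq_comm]
  | cons a l ih =>
    rcases r with _ | r
    · simp at hl
    obtain ⟨a, rfl⟩ := Nat.exists_eq_succ_of_ne_zero (hpos a (by simp)).ne'
    have hl' : l.length ≤ r := by simpa using hl
    have hpos' : ∀ b ∈ l, 0 < b := fun b hb => hpos b (by simp [hb])
    obtain ⟨s, hs, h1⟩ := ih r hl' hpos'
    obtain ⟨t, -, h2⟩ := ih (r + 1) (by omega) hpos'
    rw [if_neg (by omega)] at h2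
    refine ⟨(-1) ^ (a * r) * s, (isUnit_one.neg.pow _).mul hs, ?_⟩
    obtain ⟨y, hy⟩ := toOdd_surjective (oddHList 𝕜 l)
    have h3 : oddE 𝕜 (r + 1) (oddHList 𝕜 (a.succ :: l)) =
        (-1 : 𝕜) ^ ((a + 1) * (r + 1)) • (oddH 𝕜 (a + 1) * oddE 𝕜 (r + 1) (oddHList 𝕜 l)) +
        (-1 : 𝕜) ^ (a * r) • (oddH 𝕜 a * oddE 𝕜 r (oddHList 𝕜 l)) := by
      rw [oddHList_cons, ← hy, ← toOdd_freeH, ← map_mul, oddE_toOdd, Nat.succ_eq_add_one,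
        freeE_succ_freeH_succ_mul]
      simp only [map_add, map_smul, map_mul, oddE_toOdd, toOdd_freeH]
    rw [h3, h2, h1, mul_zero, smul_zero, zero_add]
    simp only [List.length_cons, add_left_inj]
    split_ifs with h
    · simp [smul_smul]
    · simp


/-- Removing the first column from a partition. -/
def removeColumn (l : List ℕ) : List ℕ := (l.map Nat.pred).filter (0 < ·)

theorem oddHList_filter (l : List ℕ) : oddHList 𝕜 (l.filter (0 < ·)) = oddHList 𝕜 l := by
  induction l with
  | nil => rfl
  | cons a l ih =>
    rcases Nat.eq_zero_or_pos a with rfl | ha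
    · simp [ih, oddH_zero]
    · simp [ih, ha]

/-- The zeros of a decreasing list are all at its end, so its length and its positive entries
determine it. This makes `removeColumn` injective on partitions with a fixed number of parts. -/
theorem eq_filter_append_replicate {l : List ℕ} (hl : l.Pairwise (· ≥ ·)) :
    l = l.filter (0 < ·) ++ List.replicate (l.length - (l.filter (0 < ·)).length) 0 := by
  induction l with
  | nil => rfl
  | cons a l ih =>
    rw [List.pairwise_cons] at hl
    rcases Nat.eq_zero_or_pos a with rfl | ha
    · have h0 : ∀ b ∈ l, b = 0 := fun b hb => Nat.le_zero.1 (hl.1 b hb)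
      have h1 : (0 :: l).filter (0 < ·) = [] := by
        rw [List.filter_eq_nil_iff]
        intro b hb
        rcases List.mem_cons.1 hb with rfl | hb
        · simp
        · simp [h0 b hb]
      rw [h1]
      simp only [List.nil_append, List.length_nil, Nat.sub_zero, List.length_cons]
      rw [List.eq_replicate_iff]
      refine ⟨by simp, fun b hb => ?_⟩
      rcases List.mem_cons.1 hb with rfl | hb
      · rfl
      · exact h0 b hb
    · have h1 : (a :: l).filter (0 < ·) = a :: l.filter (0 < ·) := by simp [ha]
      rw [h1, List.cons_append, List.length_cons, List.length_cons, Nat.add_sub_add_right]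
      exact congrArg _ (ih hl.2)

theorem pairwise_map_pred {l : List ℕ} (hl : l.Pairwise (· ≥ ·)) :
    (l.map Nat.pred).Pairwise (· ≥ ·) :=
  hl.map _ fun _ _ hab => Nat.pred_le_pred hab

theorem removeColumn_injective {n : ℕ} {l l' : List ℕ} (hl : IsPartList n l)
    (hl' : IsPartList n l') (hlen : l.length = l'.length)
    (h : removeColumn l = removeColumn l') : l = l' := by
  have hsucc : ∀ {l : List ℕ}, IsPartList n l → (l.map Nat.pred).map Nat.succ = l := by
    intro l hl
    rw [List.map_map]
    conv_rhs => rw [← List.map_id l]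
    exact List.map_congr_left fun a ha => Nat.succ_pred_eq_of_pos (hl.2.1 a ha)
  have h1 : l.map Nat.pred = l'.map Nat.pred := by
    rw [eq_filter_append_replicate (pairwise_map_pred hl.1), eq_filter_append_replicate (pairwise_map_pred hl'.1)]
    unfold removeColumn at h
    rw [h, List.length_map, List.length_map, hlen]
  rw [← hsucc hl, ← hsucc hl', h1]

theorem isPartList_removeColumn {n : ℕ} {l : List ℕ} (hl : IsPartList n l) :
    IsPartList (n - l.length) (removeColumn l) := by
  obtain ⟨h1, h2, rfl⟩ := hl
  refine ⟨(pairwise_map_pred h1).filter _, ?_, ?_⟩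
  · intro a ha
    simpa using (List.mem_filter.1 ha).2
  · have e1 : ∀ l : List ℕ, (l.filter (0 < ·)).sum = l.sum := by
      intro l
      induction l with
      | nil => rfl
      | cons a l ih =>
        rcases Nat.eq_zero_or_pos a with rfl | ha
        · simp [ih]
        · simp [ih, ha]
    rw [removeColumn, e1]
    clear h1
    induction l with
    | nil => rfl
    | cons a l ih =>
      have ha := h2 a (by simp)
      have h3 := fun b (hb : b ∈ l) => h2 b (by simp [hb])
      have h4 := List.length_le_sum_of_one_le l h3
      simp only [List.map_cons, List.sum_cons, List.length_cons, ih h3,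
        Nat.pred_eq_sub_one] at h4 ⊢
      omega

/-- In a nontrivial relation let r be the largest number of parts occurring. E_r kills the shorter
terms and strips the first column from the rest, leaving a nontrivial relation in degree n - r. -/
theorem coeff_eq_zero_of_sum_oddHList {n : ℕ} {S : Finset (List ℕ)} {c : List ℕ → 𝕜}
    (hS : ∀ l ∈ S, IsPartList n l) (h : ∑ l ∈ S, c l • oddHList 𝕜 l = 0) : ∀ l ∈ S, c l = 0 := by
  classical
  induction n using Nat.strong_induction_on generalizing S c with
  | _ n ih =>
    rcases Nat.eq_zero_or_pos n with rfl | hn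
    · have hnil : ∀ l ∈ S, l = [] := by
        intro l hl
        obtain ⟨-, h2, h3⟩ := hS l hl
        rcases l with _ | ⟨a, l⟩
        · rfl
        · have := h2 a (by simp)
          rw [List.sum_cons] at h3
          omega
      intro l hl
      have hSl : S = {l} := by
        ext l'
        rw [mem_singleton]
        exact ⟨fun h' => (hnil l' h').trans (hnil l hl).symm, fun h' => h' ▸ hl⟩
      rw [hSl, sum_singleton, hnil l hl] at h
      have := congrArg (oddCounit 𝕜) h
      rw [hnil l hl]
      simpa using this
    · by_contra! hne
      obtain ⟨l₀, hl₀, hc₀⟩ := hne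
      set S' := S.filter fun l => c l ≠ 0 with hS'
      have hmem : l₀ ∈ S' := by simp [hS', hl₀, hc₀]
      obtain ⟨m, hm, hmax⟩ := S'.exists_max_image List.length ⟨l₀, hmem⟩
      have hmS : IsPartList n m := hS m (mem_filter.1 hm).1
      have hr : 0 < m.length := by
        rw [List.length_pos_iff]
        rintro rfl
        have : (0 : ℕ) = n := hmS.2.2
        omega
      have hsum : ∑ l ∈ S', c l • oddHList 𝕜 l = 0 := by
        rw [← h, hS', sum_filter_of_ne]
        intro l _ h1 h2
        exact h1 (by rw [h2, zero_smul])
      have hE : ∀ l ∈ S', ∃ s : 𝕜, IsUnit s ∧ oddE 𝕜 m.length (oddHList 𝕜 l) =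
          if l.length = m.length then s • oddHList 𝕜 (l.map Nat.pred) else 0 := fun l hl =>
        oddE_oddHList m.length l (hmax l hl) (hS l (mem_filter.1 hl).1).2.1
      choose! s hs hsE using hE
      have h2 := congrArg (oddE 𝕜 m.length) hsum
      rw [map_sum, map_zero] at h2
      set T := S'.filter fun l => l.length = m.length with hT
      have hTS : ∀ l ∈ T, IsPartList n l := fun l hl =>
        hS l (mem_filter.1 (mem_filter.1 hl).1).1
      have hinj : Set.InjOn removeColumn (T : Set (List ℕ)) := by
        intro l hl l' hl' heq
        exact removeColumn_injective (hTS l hl) (hTS l' hl')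
          ((mem_filter.1 hl).2.trans (mem_filter.1 hl').2.symm) heq
      have h3 : ∑ l ∈ T, (c l * s l) • oddHList 𝕜 (removeColumn l) = 0 := by
        rw [← h2, hT, sum_filter]
        refine sum_congr rfl fun l hl => ?_
        rw [map_smul, hsE l hl, removeColumn, oddHList_filter]
        split_ifs
        · rw [smul_smul]
        · rw [smul_zero]
      -- The coefficients are carried along the injective map `removeColumn`, so that the induction
      -- hypothesis applies to a sum over distinct partitions.
      have h4 : ∑ l ∈ T.image removeColumn,
          (fun l' => c (Function.invFunOn removeColumn (T : Set (List ℕ)) l') *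
            s (Function.invFunOn removeColumn (T : Set (List ℕ)) l')) l • oddHList 𝕜 l = 0 := by
        rw [sum_image hinj, ← h3]
        refine sum_congr rfl fun l hl => ?_
        simp only [hinj.leftInvOn_invFunOn hl]
      have hmT : m ∈ T := by simp [hT, hm]
      have h5 := ih (n - m.length) (by omega) (S := T.image removeColumn) (by
        intro l' hl'
        obtain ⟨l, hl, rfl⟩ := mem_image.1 hl'
        rw [← (mem_filter.1 hl).2]
        exact isPartList_removeColumn (hTS l hl)) h4 _ (mem_image_of_mem _ hmT)
      simp only [hinj.leftInvOn_invFunOn (mem_coe.2 hmT)] at h5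
      exact (mem_filter.1 hm).2 ((hs m hm).mul_left_eq_zero.1 h5)

/-! ### The form on the algebra of odd symmetric functions -/

/-- The bilinear form on `Λ`, as a bilinear map. -/
def oddBilin (𝕜 : Type*) [CommRing 𝕜] : LinearMap.BilinForm 𝕜 (OddLambda 𝕜) :=
  LinearMap.mk₂ 𝕜 oddForm
    (by
      intro x y z
      obtain ⟨x, rfl⟩ := toOdd_surjective x
      obtain ⟨y, rfl⟩ := toOdd_surjective y
      obtain ⟨z, rfl⟩ := toOdd_surjective z
      rw [← map_add, oddForm_toOdd, oddForm_toOdd, oddForm_toOdd, map_add, LinearMap.add_apply])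
    (by
      intro r x y
      obtain ⟨x, rfl⟩ := toOdd_surjective x
      obtain ⟨y, rfl⟩ := toOdd_surjective y
      rw [← map_smul, oddForm_toOdd, oddForm_toOdd, map_smul, LinearMap.smul_apply])
    (by
      intro x y z
      obtain ⟨x, rfl⟩ := toOdd_surjective x
      obtain ⟨y, rfl⟩ := toOdd_surjective y
      obtain ⟨z, rfl⟩ := toOdd_surjective z
      rw [← map_add, oddForm_toOdd, oddForm_toOdd, oddForm_toOdd, map_add])
    (by
      intro r x y
      obtain ⟨x, rfl⟩ := toOdd_surjective x
      obtain ⟨y, rfl⟩ := toOdd_surjective y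
      rw [← map_smul, oddForm_toOdd, oddForm_toOdd, map_smul])

theorem oddBilin_apply (x y : OddLambda 𝕜) : oddBilin 𝕜 x y = oddForm x y := rfl

theorem oddForm_one_left (x : OddLambda 𝕜) : oddForm 1 x = oddCounit 𝕜 x := by
  obtain ⟨x, rfl⟩ := toOdd_surjective x
  rw [← map_one (toOdd 𝕜), oddForm_toOdd, freeForm_one_left, oddCounit_toOdd]

theorem oddForm_oddH_mul (c : ℕ) (x y : OddLambda 𝕜) :
    oddForm (oddH 𝕜 c * x) y = oddForm x (oddD 𝕜 c y) := by
  obtain ⟨x, rfl⟩ := toOdd_surjective x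
  obtain ⟨y, rfl⟩ := toOdd_surjective y
  rw [← toOdd_freeH, ← map_mul, oddD_toOdd, oddForm_toOdd, oddForm_toOdd, freeForm_freeH_mul]

theorem span_oddHList : Submodule.span 𝕜 (Set.range (oddHList 𝕜)) = ⊤ := by
  rw [eq_top_iff]
  rintro x -
  obtain ⟨x, rfl⟩ := toOdd_surjective x
  have hx := (FreeAlgebra.basisFreeMonoid 𝕜 ℕ+).mem_span x
  refine Submodule.span_induction (p := fun x _ => toOdd 𝕜 x ∈ _) ?_ ?_ ?_ ?_ hx
  · rintro _ ⟨w, rfl⟩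
    exact Submodule.subset_span ⟨letters w, (toOdd_basis w).symm⟩
  · simp
  · intro x y _ _ h1 h2
    rw [map_add]
    exact Submodule.add_mem _ h1 h2
  · intro r x _ h1
    rw [map_smul]
    exact Submodule.smul_mem _ _ h1

/-- Nondegeneracy of the form on Λ, tested on a spanning set: a difference orthogonal to everything
lifts to the radical. -/
theorem eq_of_oddForm_oddHList {x y : OddLambda 𝕜}
    (h : ∀ l, oddForm (oddHList 𝕜 l) x = oddForm (oddHList 𝕜 l) y) : x = y := by
  have h1 : ∀ z, oddBilin 𝕜 z (x - y) = 0 := by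
    intro z
    have hz : z ∈ Submodule.span 𝕜 (Set.range (oddHList 𝕜)) := by
      rw [span_oddHList]
      trivial
    refine Submodule.span_induction (p := fun z _ => oddBilin 𝕜 z (x - y) = 0) ?_ ?_ ?_ ?_ hz
    · rintro _ ⟨l, rfl⟩
      rw [map_sub, oddBilin_apply, oddBilin_apply, h, sub_self]
    · simp
    · intro a b _ _ ha hb
      rw [map_add, LinearMap.add_apply, ha, hb, add_zero]
    · intro r a _ ha
      rw [map_smul, LinearMap.smul_apply, ha, smul_zero]
  rw [← sub_eq_zero]
  obtain ⟨w, hw⟩ := toOdd_surjective (x - y)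
  rw [← hw, toOdd_eq_zero_iff, mem_radical_iff]
  intro z
  rw [freeForm_comm, ← oddForm_toOdd, hw, ← oddBilin_apply]
  exact h1 _

theorem oddForm_eq_zero_of_degree {l l' : List ℕ} (h : l.sum ≠ l'.sum) :
    oddForm (oddHList 𝕜 l) (oddHList 𝕜 l') = 0 := by
  obtain ⟨v, hv, h1⟩ := exists_word_oddHList (𝕜 := 𝕜) l
  obtain ⟨w, hw, h2⟩ := exists_word_oddHList (𝕜 := 𝕜) l'
  rw [← h1, ← h2, oddForm_toOdd]
  simp only [freeForm, Module.Basis.constr_basis]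
  rw [wordPairing, dif_neg (by rwa [hv, hw])]

theorem oddForm_of_mem_oddDegree {l : List ℕ} {n : ℕ} (h : l.sum ≠ n) {x : OddLambda 𝕜}
    (hx : x ∈ oddDegree 𝕜 n) : oddForm (oddHList 𝕜 l) x = 0 := by
  rw [oddDegree_eq_span] at hx
  suffices Submodule.span 𝕜 {x | ∃ l : List ℕ, l.sum = n ∧ oddHList 𝕜 l = x} ≤
    LinearMap.ker (oddBilin 𝕜 (oddHList 𝕜 l)) from this hx
  rw [Submodule.span_le]
  rintro _ ⟨l', rfl, rfl⟩
  exact oddForm_eq_zero_of_degree h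

/-! ### The dual family -/

theorem isPartList_sort {n : ℕ} (lam : n.Partition) : IsPartList n (lam.parts.sort (· ≥ ·)) := by
  refine ⟨lam.parts.pairwise_sort _, fun a ha => lam.parts_pos (by simpa using ha), ?_⟩
  rw [← Multiset.sum_coe, Multiset.sort_eq, lam.parts_sum]

theorem oddHPart_eq {n : ℕ} (lam : n.Partition) :
    oddHPart 𝕜 lam = oddHList 𝕜 (lam.parts.sort (· ≥ ·)) := rfl

theorem exists_partition_sort_eq {n : ℕ} {l : List ℕ} (hl : IsPartList n l) :
    ∃ lam : n.Partition, lam.parts.sort (· ≥ ·) = l :=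
  ⟨⟨l, fun {i} hi => hl.2.1 i hi, by rw [Multiset.sum_coe, hl.2.2]⟩, by
    refine List.Perm.eq_of_pairwise' (r := (· ≥ ·)) (Multiset.pairwise_sort _ _) hl.1 ?_
    rw [← Multiset.coe_eq_coe, Multiset.sort_eq]⟩

theorem oddHPart_mem_oddDegree {n : ℕ} (lam : n.Partition) : oddHPart 𝕜 lam ∈ oddDegree 𝕜 n := by
  have := oddHList_mem_oddDegree (𝕜 := 𝕜) (lam.parts.sort (· ≥ ·))
  rwa [(isPartList_sort lam).2.2] at this

theorem span_oddHPart (n : ℕ) :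
    Submodule.span 𝕜 (Set.range (oddHPart 𝕜 (n := n))) = oddDegree 𝕜 n := by
  apply le_antisymm
  · rw [Submodule.span_le]
    rintro _ ⟨lam, rfl⟩
    exact oddHPart_mem_oddDegree lam
  · refine (oddDegree_le_partSpan n).trans (Submodule.span_mono ?_)
    rintro _ ⟨l, hl, -, rfl⟩
    obtain ⟨lam, hlam⟩ := exists_partition_sort_eq hl
    exact ⟨lam, by rw [oddHPart_eq, hlam]⟩

theorem sort_parts_injective {n : ℕ} :
    Function.Injective fun lam : n.Partition => lam.parts.sort (· ≥ ·) := by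
  intro lam mu h
  apply Nat.Partition.ext
  have := congrArg (fun l : List ℕ => (l : Multiset ℕ)) h
  simpa using this

theorem linearIndependent_oddHPart (n : ℕ) :
    LinearIndependent 𝕜 (oddHPart 𝕜 (n := n)) := by
  classical
  rw [Fintype.linearIndependent_iff]
  intro g hg lam
  set e : n.Partition → List ℕ := fun lam => lam.parts.sort (· ≥ ·) with he
  have hinj : Function.Injective e := sort_parts_injective
  have h1 : ∑ l ∈ univ.image e, (g ∘ Function.invFun e) l • oddHList 𝕜 l = 0 := by
    rw [sum_image hinj.injOn, ← hg]
    refine sum_congr rfl fun mu _ => ?_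
    rw [Function.comp_apply, Function.leftInverse_invFun hinj mu]
    rfl
  have h2 := coeff_eq_zero_of_sum_oddHList (n := n) (by
    intro l hl
    obtain ⟨mu, -, rfl⟩ := mem_image.1 hl
    exact isPartList_sort mu) h1 (e lam) (mem_image_of_mem _ (mem_univ _))
  rwa [Function.comp_apply, Function.leftInverse_invFun hinj lam] at h2

theorem eq_of_oddForm_oddHPart {n : ℕ} {x y : OddLambda 𝕜} (hx : x ∈ oddDegree 𝕜 n)
    (hy : y ∈ oddDegree 𝕜 n)
    (h : ∀ lam : n.Partition, oddForm (oddHPart 𝕜 lam) x = oddForm (oddHPart 𝕜 lam) y) :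
    x = y := by
  apply eq_of_oddForm_oddHList
  intro l
  by_cases hl : l.sum = n
  · have hmem : oddHList 𝕜 l ∈ Submodule.span 𝕜 (Set.range (oddHPart 𝕜 (n := n))) := by
      rw [span_oddHPart, ← hl]
      exact oddHList_mem_oddDegree l
    have hle : Submodule.span 𝕜 (Set.range (oddHPart 𝕜 (n := n))) ≤
        LinearMap.ker ((oddBilin 𝕜).flip (x - y)) := by
      rw [Submodule.span_le]
      rintro _ ⟨lam, rfl⟩
      change oddBilin 𝕜 (oddHPart 𝕜 lam) (x - y) = 0
      rw [map_sub, oddBilin_apply, oddBilin_apply, h, sub_self]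
    have h1 : oddBilin 𝕜 (oddHList 𝕜 l) (x - y) = 0 := hle hmem
    rwa [map_sub, sub_eq_zero] at h1
  · rw [oddForm_of_mem_oddDegree hl hx, oddForm_of_mem_oddDegree hl hy]

end

/-! ### Existence and uniqueness of the dual family over a field. -/

section Field

variable {𝕜 : Type*} [Field 𝕜]

/-- Pairing with the h_λ maps Λ_n injectively, by nondegeneracy, to the functions on partitions of
n. The h_λ form a basis of Λ_n, so the dimensions agree and the map is bijective. -/
theorem existsUnique_isOddMonomial (n : ℕ) :
    ∃! m : n.Partition → OddLambda 𝕜, IsOddMonomial m := by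
  let b : Module.Basis n.Partition 𝕜 (Submodule.span 𝕜 (Set.range (oddHPart 𝕜 (n := n)))) :=
    Module.Basis.span (linearIndependent_oddHPart n)
  have : Module.Finite 𝕜 (Submodule.span 𝕜 (Set.range (oddHPart 𝕜 (n := n)))) :=
    Module.Finite.of_basis b
  let f : Submodule.span 𝕜 (Set.range (oddHPart 𝕜 (n := n))) →ₗ[𝕜] (n.Partition → 𝕜) :=
    LinearMap.pi fun lam => oddBilin 𝕜 (oddHPart 𝕜 lam) ∘ₗ Submodule.subtype _
  have hf : ∀ x lam, f x lam = oddForm (oddHPart 𝕜 lam) (x : OddLambda 𝕜) := fun _ _ => rfl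
  have hmem : ∀ x : Submodule.span 𝕜 (Set.range (oddHPart 𝕜 (n := n))),
      (x : OddLambda 𝕜) ∈ oddDegree 𝕜 n := fun x => by
    rw [← span_oddHPart]
    exact x.2
  have hinj : Function.Injective f := by
    intro x y hxy
    apply Subtype.ext
    refine eq_of_oddForm_oddHPart (hmem x) (hmem y) fun lam => ?_
    rw [← hf, ← hf, hxy]
  have hsurj : Function.Surjective f := by
    refine (LinearMap.injective_iff_surjective_of_finrank_eq_finrank ?_).1 hinj
    rw [Module.finrank_eq_card_basis b, Module.finrank_pi]
  choose m hm using fun mu : n.Partition => hsurj fun lam => if lam = mu then 1 else 0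
  refine ⟨fun mu => m mu, ⟨fun mu => hmem _, fun lam mu => ?_⟩, ?_⟩
  · rw [← hf, hm]
  · intro m' hm'
    funext mu
    refine eq_of_oddForm_oddHPart (hm'.1 mu) (hmem _) fun lam => ?_
    rw [hm'.2, ← hf, hm]

theorem isOddMonomial_oddMonomial (n : ℕ) : IsOddMonomial (oddMonomial 𝕜 n) :=
  Classical.epsilon_spec (existsUnique_isOddMonomial n).exists

end Field

end OddSymm

namespace OddSymm

open Finset

noncomputable section

/-! ### The center -/

section CommRing

variable {𝕜 : Type*} [CommRing 𝕜]

theorem eq_of_oddForm_pos {x y : OddLambda 𝕜}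
    (h : ∀ l : List ℕ, (∀ a ∈ l, 0 < a) →
      oddForm (oddHList 𝕜 l) x = oddForm (oddHList 𝕜 l) y) : x = y := by
  refine eq_of_oddForm_oddHList fun l => ?_
  rw [← oddHList_filter]
  exact h _ fun a ha => by simpa using (List.mem_filter.1 ha).2

theorem oddSign_oddHList (l : List ℕ) :
    oddSign 𝕜 (oddHList 𝕜 l) = (-1 : 𝕜) ^ l.sum • oddHList 𝕜 l := by
  induction l with
  | nil => simp [oddSign_one]
  | cons a l ih =>
    rw [oddHList_cons, oddSign_mul, oddSign_oddH, ih, List.sum_cons, pow_add, smul_mul_smul_comm]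

theorem oddSign_of_mem_oddDegree {n : ℕ} (hn : Even n) {x : OddLambda 𝕜}
    (hx : x ∈ oddDegree 𝕜 n) : oddSign 𝕜 x = x := by
  rw [oddDegree_eq_span] at hx
  refine Submodule.span_induction (p := fun x _ => oddSign 𝕜 x = x) ?_ ?_ ?_ ?_ hx
  · rintro _ ⟨l, rfl, rfl⟩
    rw [oddSign_oddHList, hn.neg_one_pow, one_smul]
  · simp
  · intro x y _ _ h1 h2
    rw [map_add, h1, h2]
  · intro r x _ h1
    rw [map_smul, h1]

theorem oddSign_pow_of_fixed {x : OddLambda 𝕜} (hx : oddSign 𝕜 x = x) (j : ℕ) :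
    (oddSign 𝕜 ^ j) x = x := by
  induction j with
  | zero => rfl
  | succ j ih => rw [pow_succ', Module.End.mul_apply, ih, hx]

theorem oddSign_oddSign (x : OddLambda 𝕜) : oddSign 𝕜 (oddSign 𝕜 x) = x := by
  obtain ⟨x, rfl⟩ := toOdd_surjective x
  rw [oddSign_toOdd, oddSign_toOdd, freeSign_freeSign]

theorem oddSign_pow_even {j : ℕ} (hj : Even j) (x : OddLambda 𝕜) : (oddSign 𝕜 ^ j) x = x := by
  obtain ⟨i, rfl⟩ := hj
  rw [← two_mul, pow_mul]
  have : oddSign 𝕜 ^ 2 = 1 := LinearMap.ext fun x => by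
    rw [pow_two, Module.End.mul_apply, oddSign_oddSign, Module.End.one_apply]
  rw [this, one_pow, Module.End.one_apply]

theorem oddSign_pow_one (j : ℕ) : (oddSign 𝕜 ^ j) 1 = 1 := oddSign_pow_of_fixed oddSign_one j

/-- Indexed so that D_c(h p) and D_c(p h) can be compared term by term, with the same operator on
each factor. -/
theorem oddD_mul_swap (c : ℕ) (x y : OddLambda 𝕜) :
    oddD 𝕜 c (x * y) =
      ∑ p ∈ antidiagonal c, (oddSign 𝕜 ^ p.1) (oddD 𝕜 p.2 x) * oddD 𝕜 p.1 y := by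
  rw [oddD_mul, ← Finset.Nat.sum_antidiagonal_swap]
  rfl

theorem mem_center_of_commute_oddH {p : OddLambda 𝕜}
    (h : ∀ m, oddH 𝕜 m * p = p * oddH 𝕜 m) : p ∈ Subalgebra.center 𝕜 (OddLambda 𝕜) := by
  rw [Subalgebra.mem_center_iff]
  intro b
  have hb : b ∈ Submodule.span 𝕜 (Set.range (oddHList 𝕜)) := by
    rw [span_oddHList]
    trivial
  refine Submodule.span_induction (p := fun b _ => b * p = p * b) ?_ ?_ ?_ ?_ hb
  · rintro _ ⟨l, rfl⟩
    induction l with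
    | nil => simp
    | cons a l ih => rw [oddHList_cons, mul_assoc, ih, ← mul_assoc, h, mul_assoc]
  · simp
  · intro x y _ _ h1 h2
    rw [add_mul, mul_add, h1, h2]
  · intro r x _ h1
    rw [smul_mul_assoc, mul_smul_comm, h1]

/-- Only the terms where D_0 or D_k falls on p survive in D_c of the commutator with h_m. The D_k
terms agree because σ^k is the identity; the D_0 terms form the commutator of p with h_{m-c}, which
vanishes by induction. -/
theorem mem_center_of_primitive {k : ℕ} (hk : Even k) {p : OddLambda 𝕜} (hp : p ∈ oddDegree 𝕜 k)
    (h1 : oddD 𝕜 k p = 1) (h0 : ∀ c, 0 < c → c ≠ k → oddD 𝕜 c p = 0) :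
    p ∈ Subalgebra.center 𝕜 (OddLambda 𝕜) := by
  apply mem_center_of_commute_oddH
  intro m
  induction m using Nat.strong_induction_on with
  | _ m ih =>
    rw [← sub_eq_zero]
    refine eq_zero_of_oddD ?_ fun c hc => ?_
    · rw [map_sub, map_mul, map_mul, mul_comm, sub_self]
    · rw [map_sub, sub_eq_zero, oddD_mul, oddD_mul_swap]
      refine sum_congr rfl fun q hq => ?_
      rw [HasAntidiagonal.mem_antidiagonal] at hq
      by_cases hj : q.2 = k
      · rw [hj, h1, oddSign_pow_even hk, oddSign_pow_one, mul_one, one_mul]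
      · rcases Nat.eq_zero_or_pos q.2 with hj0 | hj0
        · rw [hj0, oddD_zero, oddSign_pow_of_fixed (oddSign_of_mem_oddDegree hk hp), pow_zero,
            Module.End.one_apply, oddD_oddH]
          split_ifs
          · exact ih _ (by omega)
          · simp
        · rw [h0 _ hj0 hj]
          simp

/-- The generator h_2 is a good test: in D_{k+1} of the commutator the unknown D_{k-1} p meets D_2
h_2 = 1 and is twisted only by σ² = 1, so it cancels. What remains is σ^k(h_1) - h_1 = -2 h_1. -/
theorem not_mem_center_of_odd (h2 : (2 : 𝕜) ≠ 0) {k : ℕ} (hk : Odd k)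
    {p : OddLambda 𝕜} (h1 : oddD 𝕜 k p = 1) (h0 : oddD 𝕜 (k + 1) p = 0) :
    p ∉ Subalgebra.center 𝕜 (OddLambda 𝕜) := by
  intro hp
  rw [Subalgebra.mem_center_iff] at hp
  have h := congrArg (oddD 𝕜 (1 + k)) (hp (oddH 𝕜 2))
  rw [oddD_mul, oddD_mul_swap, ← sub_eq_zero, ← sum_sub_distrib, sum_eq_single (1, k)] at h
  · have hσ : (oddSign 𝕜 ^ k) (oddH 𝕜 1) = -oddH 𝕜 1 := by
      obtain ⟨i, rfl⟩ := hk
      rw [pow_succ', Module.End.mul_apply, oddSign_pow_even (even_two_mul i), oddSign_oddH]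
      simp
    simp only [h1, oddSign_pow_one, oddD_oddH] at h
    rw [if_pos (by norm_num)] at h
    norm_num only at h
    rw [hσ, mul_one, one_mul] at h
    -- D_1 followed by the counit sends -2 h_1 to -2.
    have h3 := congrArg (fun x => oddCounit 𝕜 (oddD 𝕜 1 x)) h
    simp only [map_sub, map_neg, oddD_oddH, le_refl, if_true, Nat.sub_self, oddH_zero, map_one,
      map_zero] at h3
    apply h2
    linear_combination -h3
  · rintro ⟨i, j⟩ hq hne
    rw [HasAntidiagonal.mem_antidiagonal] at hq
    simp only at hq ⊢
    rcases i with _ | _ | _ | i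
    · obtain rfl : j = k + 1 := by omega
      simp [h0]
    · exact absurd (by ext <;> simp; omega) hne
    · have h3 : (oddSign 𝕜 ^ (0 + 1 + 1)) (oddD 𝕜 j p) = oddD 𝕜 j p :=
        oddSign_pow_even even_two _
      rw [h3, oddD_oddH, if_pos (by norm_num), show 2 - (0 + 1 + 1) = 0 from rfl, oddH_zero,
        oddSign_pow_one, one_mul, mul_one, sub_self]
    · rw [oddD_oddH, if_neg (by omega)]
      simp
  · intro h'
    exact absurd (by rw [HasAntidiagonal.mem_antidiagonal]) h'

end CommRing

/-! ### The operators `oddD` on the power functions, and the conclusion. -/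

section Field

variable {𝕜 : Type*} [Field 𝕜]

theorem oddPower_mem_oddDegree (k : ℕ) : oddPower 𝕜 k ∈ oddDegree 𝕜 k :=
  (isOddMonomial_oddMonomial k).1 _

theorem sort_indiscrete {k : ℕ} (hk : 0 < k) :
    (Nat.Partition.indiscrete k).parts.sort (· ≥ ·) = [k] := by
  rw [Nat.Partition.indiscrete_parts hk.ne', Multiset.sort_singleton]

theorem oddForm_oddH_oddPower {k : ℕ} (hk : 0 < k) : oddForm (oddH 𝕜 k) (oddPower 𝕜 k) = 1 := by
  have h := (isOddMonomial_oddMonomial (𝕜 := 𝕜) k).2 (Nat.Partition.indiscrete k)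
    (Nat.Partition.indiscrete k)
  rw [if_pos rfl, oddHPart_eq, sort_indiscrete hk] at h
  simpa [oddPower] using h

theorem oddForm_partSpan_two_oddPower {k : ℕ} (hk : 0 < k) {x : OddLambda 𝕜}
    (hx : x ∈ partSpan 𝕜 k 2) : oddForm x (oddPower 𝕜 k) = 0 := by
  suffices partSpan 𝕜 k 2 ≤ LinearMap.ker ((oddBilin 𝕜).flip (oddPower 𝕜 k)) from this hx
  rw [partSpan, Submodule.span_le]
  rintro _ ⟨l, hl, hlen, rfl⟩
  obtain ⟨lam, rfl⟩ := exists_partition_sort_eq hl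
  have h := (isOddMonomial_oddMonomial (𝕜 := 𝕜) k).2 lam (Nat.Partition.indiscrete k)
  rw [if_neg] at h
  · exact h
  · rintro rfl
    rw [sort_indiscrete hk] at hlen
    simp at hlen

/-- By adjunction and degree only the empty word pairs nontrivially with either side. Words are
tested with positive letters so that a nonempty one has positive degree. -/
theorem oddD_self_oddPower {k : ℕ} (hk : 0 < k) : oddD 𝕜 k (oddPower 𝕜 k) = 1 := by
  refine eq_of_oddForm_pos fun l hl => ?_
  rw [← oddForm_oddH_mul]
  rcases l with _ | ⟨a, l⟩
  · rw [oddHList_nil, mul_one, oddForm_oddH_oddPower hk, oddForm_one_left, map_one]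
  · have ha := hl a (by simp)
    rw [← oddHList_cons, oddForm_of_mem_oddDegree _ (oddPower_mem_oddDegree k), ← oddHList_nil,
      oddForm_eq_zero_of_degree]
    · simp only [List.sum_cons, List.sum_nil]
      omega
    · simp only [List.sum_cons]
      omega

theorem oddD_oddPower_of_lt {k c : ℕ} (hc : k < c) : oddD 𝕜 c (oddPower 𝕜 k) = 0 := by
  refine eq_of_oddForm_pos fun l _ => ?_
  rw [← oddForm_oddH_mul, ← oddHList_cons,
    oddForm_of_mem_oddDegree _ (oddPower_mem_oddDegree k), ← oddBilin_apply, map_zero]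
  rw [List.sum_cons]
  omega

/-- For c < k the pairing with a word moves to h_c times that word, which has no h_k component since
k is even; `oddPower` is orthogonal to every h_λ with at least two parts. -/
theorem oddD_oddPower_of_even {k c : ℕ} (hk : Even k) (hc : 0 < c) (hck : c ≠ k) :
    oddD 𝕜 c (oddPower 𝕜 k) = 0 := by
  rcases lt_or_gt_of_ne hck with hlt | hlt
  · refine eq_of_oddForm_pos fun l _ => ?_
    rw [← oddForm_oddH_mul]
    have h0 : oddForm (oddHList 𝕜 l) 0 = 0 := by rw [← oddBilin_apply, map_zero]
    rw [h0]
    by_cases hl : l.sum = k - c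
    · refine oddForm_partSpan_two_oddPower (by omega) (oddH_mul_mem_partSpan_two hk hc hlt ?_)
      rw [← hl]
      exact oddHList_mem_oddDegree l
    · rw [← oddHList_cons, oddForm_of_mem_oddDegree _ (oddPower_mem_oddDegree k)]
      rw [List.sum_cons]
      omega
  · exact oddD_oddPower_of_lt hlt

theorem oddDegree_zero_le_center :
    oddDegree 𝕜 0 ≤ Subalgebra.toSubmodule (Subalgebra.center 𝕜 (OddLambda 𝕜)) := by
  refine (oddDegree_le_partSpan 0).trans ?_
  rw [partSpan, Submodule.span_le]
  rintro _ ⟨l, ⟨-, hpos, hsum⟩, -, rfl⟩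
  rcases l with _ | ⟨a, l⟩
  · exact one_mem (Subalgebra.center 𝕜 (OddLambda 𝕜))
  · have := hpos a (by simp)
    rw [List.sum_cons] at hsum
    omega

theorem oddPower_mem_center_iff [CharZero 𝕜] (k : ℕ) :
    oddPower 𝕜 k ∈ Subalgebra.center 𝕜 (OddLambda 𝕜) ↔ Even k := by
  constructor
  · intro h
    by_contra hk
    rw [Nat.not_even_iff_odd] at hk
    exact not_mem_center_of_odd two_ne_zero hk (oddD_self_oddPower hk.pos)
      (oddD_oddPower_of_lt k.lt_succ_self) h
  · intro hk
    rcases Nat.eq_zero_or_pos k with rfl | hpos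
    · exact oddDegree_zero_le_center (oddPower_mem_oddDegree 0)
    · exact mem_center_of_primitive hk (oddPower_mem_oddDegree k) (oddD_self_oddPower hpos)
        fun c hc hck => oddD_oddPower_of_even hk hc hck

end Field

end

end OddSymm

theorem mainTheorem8 (𝕜 : Type*) [Field 𝕜] [CharZero 𝕜] :
    (∀ x : OddSymm.FreeLambda 𝕜,
        OddSymm.toOdd 𝕜 x = 0 ↔ ∀ y, OddSymm.freeForm (-1 : 𝕜) x y = 0) ∧
      (∀ n : ℕ, ∃! m : n.Partition → OddSymm.OddLambda 𝕜, OddSymm.IsOddMonomial m) ∧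
      ∀ k : ℕ,
        OddSymm.oddPower 𝕜 k ∈ Subalgebra.center 𝕜 (OddSymm.OddLambda 𝕜) ↔ Even k := by
  exact ⟨fun x => (OddSymm.toOdd_eq_zero_iff x).trans (OddSymm.mem_radical_iff x),
    fun n => OddSymm.existsUnique_isOddMonomial n, OddSymm.oddPower_mem_center_iff⟩
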